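/- Let $\gamma_\varepsilon,\gamma_w,\gamma_z>0$. A mean-zero random variable $x$ is called $\gamma$ sub-Gaussian if $\mathbb E[e^{tx}]\le e^{t^2\gamma^2/2}$ for all $t\in\mathbb R$; a random vector $x$ is called $\gamma$ sub-Gaussian if $\langle x,v\rangle$ is $\gamma$ sub-Gaussian for every Euclidean unit vector $v$. For $\theta=(K,\beta,A,\Sigma_Z,\Sigma_W,\sigma^2)$ with $A\in\mathbb R^{p\times K}$ and $\beta\in\mathbb R^K$, the pair $(X,Y)\in\mathbb R^p\times\mathbb R$ follows the sub-Gaussian factor regression model $\mathrm{sG\text{-}FRM}(\theta)$ if $X=AZ+W$ and $Y=Z^\top\beta+\varepsilon$, where $Z\in\mathbb R^K$, $W\in\mathbb R^p$, $\varepsilon\in\mathbb R$ are mutually independent with mean zero, $\mathbb E[ZZ^\top]=\Sigma_Z$, $\mathbb E[WW^\top]=\Sigma_W$, $\mathbb E[\varepsilon^2]=\sigma^2$; $A$ and $\Sigma_Z$ have rank $K$; $\varepsilon$ is $\sigma\gamma_\varepsilon$ sub-Gaussian; $Z=\Sigma_Z^{1/2}\widetilde Z$ and $W=\Sigma_W^{1/2}\widetilde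 W$, where $\widetilde Z$ is $\gamma_z$ sub-Gaussian and $\widetilde W$ is $\gamma_w$ sub-Gaussian, with mean zero, $\mathbb E[\widetilde Z\widetilde Z^\top]=\bm I_K$ and $\mathbb E[\widetilde W\widetilde W^\top]=\bm I_p$. Let the rows of $\bm X\in\mathbb R^{n\times p}$ and the entries of $\bm Y\in\mathbb R^n$ be $n$ independent copies of $(X,Y)$, and let $(X_*,Y_*)$ be a further copy independent of $(\bm X,\bm Y)$. For $B\in\mathbb R^{p\times q}$ put $\widehat Y^*_B=X_*^\top B(B^\top\bm X^\top\bm XB)^+B^\top\bm X^\top\bm Y$, where $M^+$ is the Moore--Penrose inverse, and let $\mathcal R(B)=\mathbb E[(Y_*-\widehat Y_B^*)^2]$, the expectation being over $(X_*,Y_*)$ only. Write $\lambda_1(\Sigma_W)\ge\dots\ge\lambda_p(\Sigma_W)$ for the eigenvalues of $\Sigma_W$ and $\kappa(\Sigma_W)=\lambda_1(\Sigma_W)/\lambda_p(\Sigma_W)$. There are constants $C_1,C_2>0$ depending only on $\gamma_\varepsilon,\gamma_w,\gamma_z$ such that the following holds for all $c_0\in(0,1)$, $C>0$, $c>0$ and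 all integers $n,p\ge1$. If $p\log n\le c_0n$, then for every $\theta$ with $K\log n\le Cn$ and $\lambda_p(\Sigma_W)>c$ and every $(X,Y)\sim\mathrm{sG\text{-}FRM}(\theta)$, the least squares predictor ($B=\bm I_p$) satisfies $$\mathbb P\left\{\mathcal R(\bm I_p)-\sigma^2\le C_1\left(\frac{p+\log n}{n}\,\sigma^2+\|\Sigma_W\|_{\mathrm{op}}\,\beta^\top(A^\top A)^{-1}\beta\right)\kappa(\Sigma_W)\right\}\ge 1-\frac{C_2}{n}.$$ -/

import Mathlib

open MeasureTheory ProbabilityTheory Matrix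

noncomputable section

namespace FactorRegression

/-! ### Matrices -/

/-- The four Penrose equations: `N` is a Moore-Penrose inverse of the real matrix `M`. -/
structure IsMoorePenrose {m n : Type*} [Fintype m] [Fintype n]
    (M : Matrix m n ℝ) (N : Matrix n m ℝ) : Prop where
  mul_mul_left : M * N * M = M
  mul_mul_right : N * M * N = N
  symm_left : (M * N)ᵀ = M * N
  symm_right : (N * M)ᵀ = N * M

theorem isHermitian_gram {m n : Type*} [Fintype m] [Fintype n]
    (M : Matrix m n ℝ) : (Mᵀ * M).IsHermitian := by
  rw [← conjTranspose_eq_transpose_of_trivial]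
  exact isHermitian_conjTranspose_mul_self M

/-- The Moore-Penrose inverse `M⁺ = (Mᵀ M)⁺ Mᵀ`, where `(Mᵀ M)⁺` is obtained from the spectral
decomposition of `Mᵀ M` by inverting the nonzero eigenvalues (in Lean `0⁻¹ = 0`). -/
def pinv {m n : Type*} [Fintype m] [Fintype n] [DecidableEq n] (M : Matrix m n ℝ) :
    Matrix n m ℝ :=
  let h : (Mᵀ * M).IsHermitian := isHermitian_gram M
  (h.eigenvectorUnitary : Matrix n n ℝ) * diagonal (fun i => (h.eigenvalues i)⁻¹) *
    (h.eigenvectorUnitary : Matrix n n ℝ)ᵀ * Mᵀ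

theorem IsMoorePenrose.unique {m n : Type*} [Fintype m] [Fintype n]
    {M : Matrix m n ℝ} {N N' : Matrix n m ℝ}
    (h : IsMoorePenrose M N) (h' : IsMoorePenrose M N') : N = N' := by
  have e1 : M * N = M * N' := by
    calc M * N = (M * N)ᵀ := h.symm_left.symm
      _ = ((M * N') * (M * N))ᵀ := by rw [← Matrix.mul_assoc, h'.mul_mul_left]
      _ = (M * N)ᵀ * (M * N')ᵀ := transpose_mul _ _
      _ = M * N * (M * N') := by rw [h.symm_left, h'.symm_left]
      _ = M * N' := by rw [← Matrix.mul_assoc, h.mul_mul_left]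
  have e2 : N * M = N' * M := by
    calc N * M = (N * M)ᵀ := h.symm_right.symm
      _ = ((N * M) * (N' * M))ᵀ := by
          rw [Matrix.mul_assoc, ← Matrix.mul_assoc M, h'.mul_mul_left]
      _ = (N' * M)ᵀ * (N * M)ᵀ := transpose_mul _ _
      _ = N' * M * (N * M) := by rw [h.symm_right, h'.symm_right]
      _ = N' * M := by rw [Matrix.mul_assoc, ← Matrix.mul_assoc M, h.mul_mul_left]
  calc N = N * M * N := h.mul_mul_right.symm
    _ = N' * M * N' := by rw [e2, Matrix.mul_assoc, e1, ← Matrix.mul_assoc]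
    _ = N' := h'.mul_mul_right

theorem isMoorePenrose_pinv {m n : Type*} [Fintype m] [Fintype n] [DecidableEq n]
    (M : Matrix m n ℝ) : IsMoorePenrose M (pinv M) := by
  have h : (Mᵀ * M).IsHermitian := isHermitian_gram M
  set U : Matrix n n ℝ := (h.eigenvectorUnitary : Matrix n n ℝ) with hU
  set H : Matrix n n ℝ := U * diagonal (fun i => (h.eigenvalues i)⁻¹) * Uᵀ with hH
  have hN : pinv M = H * Mᵀ := rfl
  have hUU : Uᵀ * U = 1 := by
    have := Unitary.coe_star_mul_self h.eigenvectorUnitary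
    simpa [Matrix.star_eq_conjTranspose, conjTranspose_eq_transpose_of_trivial] using this
  have hG : Mᵀ * M = U * diagonal h.eigenvalues * Uᵀ := by
    have := h.spectral_theorem
    rw [Unitary.conjStarAlgAut_apply] at this
    simpa [Matrix.star_eq_conjTranspose, conjTranspose_eq_transpose_of_trivial,
      Function.comp_def] using this
  have cancel : ∀ a b : n → ℝ, U * diagonal a * Uᵀ * (U * diagonal b * Uᵀ)
      = U * diagonal (fun i => a i * b i) * Uᵀ := by
    intro a b
    rw [← diagonal_mul_diagonal]
    calc U * diagonal a * Uᵀ * (U * diagonal b * Uᵀ)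
        = U * diagonal a * (Uᵀ * U) * diagonal b * Uᵀ := by simp only [Matrix.mul_assoc]
      _ = _ := by rw [hUU]; simp only [Matrix.mul_assoc, Matrix.one_mul]
  have tr : ∀ a : n → ℝ, (U * diagonal a * Uᵀ)ᵀ = U * diagonal a * Uᵀ := by
    intro a
    simp [transpose_mul, Matrix.mul_assoc]
  have hHt : Hᵀ = H := tr _
  have hHGH : H * (Mᵀ * M) * H = H := by
    rw [hG, hH, cancel, cancel]
    congr 3
    funext i
    by_cases h0 : h.eigenvalues i = 0 <;> simp [h0]
  have hGHG : Mᵀ * M * H * (Mᵀ * M) = Mᵀ * M := by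
    rw [hG, hH, cancel, cancel]
    congr 3
    funext i
    by_cases h0 : h.eigenvalues i = 0 <;> simp [h0]
  have hHGt : (H * (Mᵀ * M))ᵀ = H * (Mᵀ * M) := by
    rw [hG, hH, cancel, tr]
  have hzero : M * (H * (Mᵀ * M)) - M = 0 := by
    rw [← conjTranspose_mul_self_eq_zero, conjTranspose_eq_transpose_of_trivial]
    have : Mᵀ * (M * (H * (Mᵀ * M)) - M) = 0 := by
      rw [Matrix.mul_sub, sub_eq_zero]
      simpa only [Matrix.mul_assoc] using hGHG
    rw [transpose_sub, transpose_mul, hHGt, Matrix.sub_mul, Matrix.mul_assoc (H * (Mᵀ * M)), this]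
    simp
  refine ⟨?_, ?_, ?_, ?_⟩
  · rw [hN]
    simpa only [Matrix.mul_assoc] using sub_eq_zero.mp hzero
  · rw [hN]
    calc H * Mᵀ * M * (H * Mᵀ) = H * (Mᵀ * M) * H * Mᵀ := by simp only [Matrix.mul_assoc]
      _ = H * Mᵀ := by rw [hHGH]
  · rw [hN]
    simp [transpose_mul, hHt, Matrix.mul_assoc]
  · rw [hN, Matrix.mul_assoc, hHGt]

/-- The operator norm `‖M‖_op = σ₁(M)`: the norm of `M` as a map between Euclidean spaces. -/
def opNorm {m n : ℕ} (M : Matrix (Fin m) (Fin n) ℝ) : ℝ :=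
  ‖(Matrix.toEuclideanLin M).toContinuousLinearMap‖

/-- The eigenvalues of a symmetric `p × p` matrix in non-increasing order, indexed from `0`
(with value `0` if the matrix is not symmetric). -/
def sortedEigenvalue {p : ℕ} (Q : Matrix (Fin p) (Fin p) ℝ) (k : Fin p) : ℝ :=
  open Classical in
  if h : Q.IsHermitian then h.eigenvalues₀ (Fin.cast (Fintype.card_fin p).symm k) else 0

/-- The largest eigenvalue `λ₁(Q)`. -/
def lambdaMax {p : ℕ} [NeZero p] (Q : Matrix (Fin p) (Fin p) ℝ) : ℝ :=
  sortedEigenvalue Q 0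

/-- The smallest eigenvalue `λ_p(Q)`; `Fin.rev 0` is the last index `p - 1`. -/
def lambdaMin {p : ℕ} [NeZero p] (Q : Matrix (Fin p) (Fin p) ℝ) : ℝ :=
  sortedEigenvalue Q (Fin.rev 0)

/-- The condition number `κ(Q) = λ₁(Q) / λ_p(Q)`. -/
def condNumber {p : ℕ} [NeZero p] (Q : Matrix (Fin p) (Fin p) ℝ) : ℝ :=
  lambdaMax Q / lambdaMin Q

open scoped MatrixOrder in
/-- The symmetric positive semi-definite square root of a positive semi-definite matrix. -/
def sqrtMatrix {d : ℕ} (Q : Matrix (Fin d) (Fin d) ℝ) : Matrix (Fin d) (Fin d) ℝ :=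
  CFC.sqrt Q

/-! ### Sub-Gaussian random variables and vectors -/

/-- `x` is a mean zero, `γ` sub-Gaussian random variable:
`E[exp (t x)] ≤ exp (t² γ² / 2)` for all real `t`. -/
structure IsSubGaussian {Ω : Type*} [MeasurableSpace Ω] (μ : Measure Ω) (γ : ℝ) (x : Ω → ℝ) :
    Prop where
  mean_zero : ∫ ω, x ω ∂μ = 0
  subgaussian : HasSubgaussianMGF x (Real.toNNReal (γ ^ 2)) μ

/-- `x` is a `γ` sub-Gaussian random vector: `⟨x, v⟩` is `γ` sub-Gaussian for each unit `v`. -/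
def IsSubGaussianVector {Ω : Type*} [MeasurableSpace Ω] {d : ℕ} (μ : Measure Ω) (γ : ℝ)
    (x : Ω → Fin d → ℝ) : Prop :=
  ∀ v : Fin d → ℝ, v ⬝ᵥ v = 1 → IsSubGaussian μ γ (fun ω => x ω ⬝ᵥ v)

/-! ### The factor regression model -/

/-- The parameter `θ = (K, β, A, Σ_Z, Σ_W, σ²)`. -/
structure Param (p : ℕ) where
  K : ℕ
  β : Fin K → ℝ
  A : Matrix (Fin p) (Fin K) ℝ
  SigmaZ : Matrix (Fin K) (Fin K) ℝ
  SigmaW : Matrix (Fin p) (Fin p) ℝ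
  sigmaSq : ℝ

/-- `x` is a centred, square integrable random vector with `E[x xᵀ] = S`. -/
structure HasSecondMoment {Ω : Type*} [MeasurableSpace Ω] {d : ℕ} (μ : Measure Ω)
    (x : Ω → Fin d → ℝ) (S : Matrix (Fin d) (Fin d) ℝ) : Prop where
  measurable : Measurable x
  memLp : MemLp x 2 μ
  mean_zero : ∀ i, ∫ ω, x ω i ∂μ = 0
  second_moment : ∀ i j, ∫ ω, x ω i * x ω j ∂μ = S i j

/-- `(X, Y)` follows the factor regression model `FRM(θ)` with latent vector `Z` and
noises `W`, `ε`. -/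
structure IsFRM {Ω : Type*} [MeasurableSpace Ω] {p : ℕ} (μ : Measure Ω) (θ : Param p)
    (X : Ω → Fin p → ℝ) (Y : Ω → ℝ)
    (Z : Ω → Fin θ.K → ℝ) (W : Ω → Fin p → ℝ) (ε : Ω → ℝ) : Prop where
  eq_X : ∀ᵐ ω ∂μ, X ω = θ.A *ᵥ Z ω + W ω
  eq_Y : ∀ᵐ ω ∂μ, Y ω = Z ω ⬝ᵥ θ.β + ε ω
  /- The next two fields together say that `Z`, `W`, `ε` are mutually independent. -/
  indep_Z : IndepFun Z (fun ω => (W ω, ε ω)) μ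
  indep_W : IndepFun W ε μ
  moments_Z : HasSecondMoment μ Z θ.SigmaZ
  moments_W : HasSecondMoment μ W θ.SigmaW
  measurable_ε : Measurable ε
  memLp_ε : MemLp ε 2 μ
  mean_ε : ∫ ω, ε ω ∂μ = 0
  second_moment_ε : ∫ ω, ε ω ^ 2 ∂μ = θ.sigmaSq
  rank_A : θ.A.rank = θ.K
  rank_SigmaZ : θ.SigmaZ.rank = θ.K

/-- `x = S^{1/2} x'` for a `γ` sub-Gaussian random vector `x'` with `E[x' x'ᵀ] = I`. -/
def IsColoredSubGaussian {Ω : Type*} [MeasurableSpace Ω] {d : ℕ} (μ : Measure Ω) (γ : ℝ)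
    (S : Matrix (Fin d) (Fin d) ℝ) (x : Ω → Fin d → ℝ) : Prop :=
  ∃ x' : Ω → Fin d → ℝ, HasSecondMoment μ x' 1 ∧ IsSubGaussianVector μ γ x' ∧
    ∀ᵐ ω ∂μ, x ω = sqrtMatrix S *ᵥ x' ω

/-- `(X, Y) ∼ sG-FRM(θ)`, the sub-Gaussian factor regression model with sub-Gaussian
constants `γε`, `γw`, `γz`. -/
def IsSubGaussianFRM {Ω : Type*} [MeasurableSpace Ω] {p : ℕ} (γε γw γz : ℝ) (μ : Measure Ω)
    (θ : Param p) (X : Ω → Fin p → ℝ) (Y : Ω → ℝ) : Prop :=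
  ∃ (Z : Ω → Fin θ.K → ℝ) (W : Ω → Fin p → ℝ) (ε : Ω → ℝ),
    IsFRM μ θ X Y Z W ε ∧
    IsSubGaussian μ (Real.sqrt θ.sigmaSq * γε) ε ∧
    IsColoredSubGaussian μ γz θ.SigmaZ Z ∧
    IsColoredSubGaussian μ γw θ.SigmaW W

/-! ### Sample, predictor, risk -/

/-- `(X i, Y i)`, `i : Fin n`, are `n` independent copies of `(X₀, Y₀)`. -/
structure IsIIDSample {Ω Ω₀ : Type*} [MeasurableSpace Ω] [MeasurableSpace Ω₀] {n p : ℕ}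
    (P : Measure Ω) (μ : Measure Ω₀) (X : Fin n → Ω → Fin p → ℝ) (Y : Fin n → Ω → ℝ)
    (X₀ : Ω₀ → Fin p → ℝ) (Y₀ : Ω₀ → ℝ) : Prop where
  indep : iIndepFun (fun i ω => (X i ω, Y i ω)) P
  ident : ∀ i, IdentDistrib (fun ω => (X i ω, Y i ω)) (fun ω => (X₀ ω, Y₀ ω)) P μ

/-- The coefficient vector `B (Bᵀ 𝐗ᵀ 𝐗 B)⁺ Bᵀ 𝐗ᵀ 𝐘` of the linear predictor attached to `B`. -/
def coef {n p q : ℕ} (XX : Matrix (Fin n) (Fin p) ℝ) (YY : Fin n → ℝ)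
    (B : Matrix (Fin p) (Fin q) ℝ) : Fin p → ℝ :=
  (B * pinv (Bᵀ * XXᵀ * XX * B) * Bᵀ * XXᵀ) *ᵥ YY

/-- The prediction risk `E[(Y_* - X_*ᵀ α)²]` of the predictor with coefficient vector
`α = coef XX YY B`; the expectation is over the new data point `(X_*, Y_*)` only, the training
data `(XX, YY)` being fixed. -/
def risk {Ω₀ : Type*} [MeasurableSpace Ω₀] {n p q : ℕ} (μ : Measure Ω₀)
    (Xs : Ω₀ → Fin p → ℝ) (Ys : Ω₀ → ℝ)
    (XX : Matrix (Fin n) (Fin p) ℝ) (YY : Fin n → ℝ) (B : Matrix (Fin p) (Fin q) ℝ) : ℝ :=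
  ∫ ω, (Ys ω - Xs ω ⬝ᵥ coef XX YY B) ^ 2 ∂μ

end FactorRegression

end

/-! Put a = A(AᵀA)⁻¹β. Then Aᵀa = β, so Zᵀβ = (X − W)ᵀa and Y = Xᵀa + ε − Wᵀa. This is a linear
model with coefficient a, a noise ε uncorrelated with X, and a remainder Wᵀa that is correlated with
X but small: E(Wᵀa)² = aᵀΣ_W a ≤ ‖Σ_W‖ βᵀ(AᵀA)⁻¹β. With S = AΣ_ZAᵀ + Σ_W, the second moment of X,
the excess risk of a coefficient vector α is at most 2(α−a)ᵀS(α−a) + 2E(Wᵀa)²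
(`IsSubGaussianFRM.exists_design`).

It remains to bound d = α − a for least squares in the norm of S. On a good sample the empirical
Gram matrix is at least nS/2, the noise term is at most 2nt√(dᵀSd) uniformly in d, and the remainder
has empirical second moment at most 2. The normal equations then give dᵀSd ≲ σ²t² + E(Wᵀa)²
deterministically (`IsGoodSample.estimation_error_le`); the correlation of the remainder with the
design is harmless because that term is handled by Cauchy-Schwarz alone.

Good samples are likely by Bernstein's inequality on a net of 25^p points of the ellipsoid vᵀSv ≤ 1
(`IsSubGaussianDesign.measure_not_isGoodSample_le`), with t² of order (p + log n)/n. Measuring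
everything in the norm of S avoids any conditioning of S, so the factor κ(Σ_W) enters only through κ
≥ 1. -/

noncomputable section

namespace FactorRegression

/-! ### Sub-exponential random variables -/

/-- `q` is sub-exponential at scale `s`: `E[exp (s |q|)] ≤ 2`. -/
structure IsSubExponential {Ω : Type*} [MeasurableSpace Ω] (μ : Measure Ω) (s : ℝ) (q : Ω → ℝ) :
    Prop where
  measurable : Measurable q
  integrable : Integrable (fun ω => Real.exp (s * |q ω|)) μ
  integral_le : ∫ ω, Real.exp (s * |q ω|) ∂μ ≤ 2

/-- The exact value is √2. This is what remains after a squared sub-Gaussian variable has been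
linearised by an independent Gaussian. -/
theorem lintegral_exp_sq_gaussianReal :
    ∫⁻ g, ENNReal.ofReal (Real.exp (g ^ 2 / 4)) ∂(gaussianReal 0 1) ≤ 2 := by
  rw [gaussianReal_of_var_ne_zero _ one_ne_zero,
    lintegral_withDensity_eq_lintegral_mul _ (measurable_gaussianPDF 0 1) (by fun_prop)]
  have h : ∀ g : ℝ, (gaussianPDF 0 1 * fun g => ENNReal.ofReal (Real.exp (g ^ 2 / 4))) g
      = ENNReal.ofReal ((√(2 * Real.pi))⁻¹ * Real.exp (-(1 / 4) * g ^ 2)) := by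
    intro g
    rw [Pi.mul_apply, gaussianPDF, ← ENNReal.ofReal_mul (gaussianPDFReal_nonneg 0 1 g),
      gaussianPDFReal]
    congr 1
    simp only [NNReal.coe_one, mul_one, sub_zero, mul_assoc, ← Real.exp_add]
    congr 2
    ring
  simp_rw [h]
  have hint : Integrable (fun g : ℝ => (√(2 * Real.pi))⁻¹ * Real.exp (-(1 / 4) * g ^ 2)) :=
    (integrable_exp_neg_mul_sq (by norm_num)).const_mul _
  rw [← ofReal_integral_eq_lintegral_ofReal hint (ae_of_all _ fun g => by positivity),
    integral_const_mul, integral_gaussian, ← Real.sqrt_inv, ← Real.sqrt_mul (by positivity)]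
  have h2 : (2 * Real.pi)⁻¹ * (Real.pi / (1 / 4)) = 2 := by
    field_simp
    norm_num
  rw [h2]
  have h3 : √(2 : ℝ) ≤ 2 := by
    rw [Real.sqrt_le_left (by norm_num)]
    norm_num
  simp [h3]

theorem lintegral_exp_mul_gaussianReal (t : ℝ) :
    ∫⁻ g, ENNReal.ofReal (Real.exp (t * g)) ∂(gaussianReal 0 1)
      = ENNReal.ofReal (Real.exp (t ^ 2 / 2)) := by
  rw [← ofReal_integral_eq_lintegral_ofReal (integrable_exp_mul_gaussianReal t)
    (ae_of_all _ fun g => by positivity)]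
  have := congrFun (mgf_id_gaussianReal (μ := 0) (v := 1)) t
  simp only [mgf, id, NNReal.coe_one, zero_mul, zero_add, one_mul] at this
  rw [this]

/-- The square of a sub-Gaussian variable is sub-exponential. -/
theorem isSubExponential_sq {Ω : Type*} [MeasurableSpace Ω] {μ : Measure Ω}
    [IsProbabilityMeasure μ] {x : Ω → ℝ} {c : NNReal} {s : ℝ} (hx : Measurable x)
    (h : HasSubgaussianMGF x c μ) (hs : 0 ≤ s) (hsc : 4 * c * s ≤ 1) :
    IsSubExponential μ s (fun ω => x ω ^ 2) := by
  have hle : ∫⁻ ω, ENNReal.ofReal (Real.exp (s * |x ω ^ 2|)) ∂μ ≤ 2 := by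
    -- Gaussian linearisation: exp(s x²) = E_g exp(√(2s) x g). After Tonelli the sub-Gaussian bound
    -- applies for each fixed g and leaves exp(c s g²) ≤ exp(g²/4). Working with `∫⁻` requires no
    -- prior integrability and yields it afterwards.
    calc ∫⁻ ω, ENNReal.ofReal (Real.exp (s * |x ω ^ 2|)) ∂μ
        = ∫⁻ ω, ∫⁻ g, ENNReal.ofReal (Real.exp (√(2 * s) * x ω * g)) ∂(gaussianReal 0 1) ∂μ := by
          refine lintegral_congr fun ω => ?_
          rw [lintegral_exp_mul_gaussianReal, abs_of_nonneg (sq_nonneg _), mul_pow,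
            Real.sq_sqrt (by positivity)]
          congr 2
          ring
      _ = ∫⁻ g, ∫⁻ ω, ENNReal.ofReal (Real.exp (√(2 * s) * x ω * g)) ∂μ ∂(gaussianReal 0 1) := by
          refine lintegral_lintegral_swap ?_
          fun_prop
      _ ≤ ∫⁻ g, ENNReal.ofReal (Real.exp (g ^ 2 / 4)) ∂(gaussianReal 0 1) := by
          refine lintegral_mono fun g => ?_
          have e : ∀ ω, √(2 * s) * x ω * g = (√(2 * s) * g) * x ω := fun ω => by ring
          simp_rw [e]
          rw [← ofReal_integral_eq_lintegral_ofReal (h.integrable_exp_mul _)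
            (ae_of_all _ fun g => by positivity)]
          refine ENNReal.ofReal_le_ofReal ((h.mgf_le _).trans (Real.exp_le_exp.2 ?_))
          rw [mul_pow, Real.sq_sqrt (by positivity)]
          nlinarith [sq_nonneg g]
      _ ≤ 2 := lintegral_exp_sq_gaussianReal
  have hm : Measurable (fun ω => Real.exp (s * |x ω ^ 2|)) := by fun_prop
  refine ⟨by fun_prop, ⟨hm.aestronglyMeasurable, ?_⟩, ?_⟩
  · rw [hasFiniteIntegral_iff_ofReal (ae_of_all _ fun g => by positivity)]
    exact hle.trans_lt (by simp)
  · rw [integral_eq_lintegral_of_nonneg_ae (ae_of_all _ fun g => by positivity)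
      hm.aestronglyMeasurable]
    exact ENNReal.toReal_le_of_le_ofReal (by norm_num) (by simpa using hle)

/-- The product of two variables with sub-exponential squares is sub-exponential. -/
theorem IsSubExponential.mul_of_sq {Ω : Type*} [MeasurableSpace Ω] {μ : Measure Ω}
    {x y : Ω → ℝ} {s : ℝ} (hs : 0 ≤ s) (hxm : Measurable x) (hym : Measurable y)
    (hx : IsSubExponential μ s (fun ω => x ω ^ 2)) (hy : IsSubExponential μ s (fun ω => y ω ^ 2)) :
    IsSubExponential μ s (fun ω => x ω * y ω) := by
  have hb : ∀ ω, Real.exp (s * |x ω * y ω|)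
      ≤ 1 / 2 * Real.exp (s * |x ω ^ 2|) + 1 / 2 * Real.exp (s * |y ω ^ 2|) := by
    intro ω
    have h1 : s * |x ω * y ω| ≤ 1 / 2 * (s * |x ω ^ 2|) + 1 / 2 * (s * |y ω ^ 2|) := by
      rw [abs_mul, abs_pow, abs_pow]
      nlinarith [mul_nonneg hs (sq_nonneg (|x ω| - |y ω|))]
    refine (Real.exp_le_exp.2 h1).trans ?_
    have := convexOn_exp.2 (Set.mem_univ (s * |x ω ^ 2|)) (Set.mem_univ (s * |y ω ^ 2|))
      (by norm_num : (0 : ℝ) ≤ 1 / 2) (by norm_num : (0 : ℝ) ≤ 1 / 2) (by norm_num)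
    simpa only [smul_eq_mul] using this
  have hint : Integrable (fun ω => 1 / 2 * Real.exp (s * |x ω ^ 2|)
      + 1 / 2 * Real.exp (s * |y ω ^ 2|)) μ :=
    (hx.integrable.const_mul _).add (hy.integrable.const_mul _)
  have hint' : Integrable (fun ω => Real.exp (s * |x ω * y ω|)) μ := by
    refine hint.mono' (Measurable.aestronglyMeasurable (by fun_prop)) (ae_of_all _ fun ω => ?_)
    rw [Real.norm_of_nonneg (by positivity)]
    exact hb ω
  refine ⟨by fun_prop, hint', (integral_mono hint' hint hb).trans ?_⟩
  rw [integral_add (hx.integrable.const_mul _) (hy.integrable.const_mul _), integral_const_mul,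
    integral_const_mul]
  linarith [hx.integral_le, hy.integral_le]

theorem exp_le_one_add_self_add_sq_mul_exp_abs (y : ℝ) :
    Real.exp y ≤ 1 + y + y ^ 2 / 2 * Real.exp |y| := by
  have key : ∀ z : ℝ, 0 ≤ z → Real.exp z ≤ 1 + z + z ^ 2 / 2 * Real.exp z := by
    intro z hz
    have hmono : MonotoneOn (fun z : ℝ => 1 + z + z ^ 2 / 2 * Real.exp z - Real.exp z)
        (Set.Ici 0) := by
      refine monotoneOn_of_deriv_nonneg (convex_Ici 0) (by fun_prop) (by fun_prop) ?_
      intro w hw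
      simp only [interior_Ici, Set.mem_Ioi] at hw
      have hd : HasDerivAt (fun z : ℝ => 1 + z + z ^ 2 / 2 * Real.exp z - Real.exp z)
          (1 + (w * Real.exp w + w ^ 2 / 2 * Real.exp w) - Real.exp w) w := by
        have h1 := (((hasDerivAt_id w).const_add 1).add
          ((((hasDerivAt_id w).pow 2).div_const 2).mul (Real.hasDerivAt_exp w))).sub
          (Real.hasDerivAt_exp w)
        refine h1.congr_deriv ?_
        simp only [id, Pi.pow_apply]
        ring
      rw [hd.deriv]
      have h2 : (1 - w) * Real.exp w ≤ 1 := by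
        have := Real.one_sub_le_exp_neg w
        calc (1 - w) * Real.exp w ≤ Real.exp (-w) * Real.exp w :=
              mul_le_mul_of_nonneg_right this (Real.exp_pos w).le
          _ = 1 := by rw [← Real.exp_add]; simp
      have : 0 ≤ w ^ 2 / 2 * Real.exp w := by positivity
      linarith
    have := hmono (Set.mem_Ici.2 le_rfl) (Set.mem_Ici.2 hz) hz
    simp only [Real.exp_zero] at this
    linarith
  rcases le_total 0 y with hy | hy
  · rw [abs_of_nonneg hy]
    exact key y hy
  · have h1 : Real.exp y ≤ 1 + y + y ^ 2 / 2 := by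
      have h := Real.quadratic_le_exp_of_nonneg (neg_nonneg.2 hy)
      have h' : Real.exp y * Real.exp (-y) = 1 := by rw [← Real.exp_add]; simp
      -- Uses (1 + y + y²/2)(1 − y + y²/2) = 1 + y⁴/4 ≥ 1.
      nlinarith [mul_le_mul_of_nonneg_left h (Real.exp_pos y).le, sq_nonneg (y ^ 2),
        Real.exp_pos y, sq_nonneg (1 + y), sq_nonneg y,
        mul_nonneg (sq_nonneg (y ^ 2)) (Real.exp_pos y).le]
    have h2 : y ^ 2 / 2 * 1 ≤ y ^ 2 / 2 * Real.exp |y| :=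
      mul_le_mul_of_nonneg_left (Real.one_le_exp (abs_nonneg y)) (by positivity)
    linarith

theorem IsSubExponential.neg {Ω : Type*} [MeasurableSpace Ω] {μ : Measure Ω} {q : Ω → ℝ} {s : ℝ}
    (h : IsSubExponential μ s q) : IsSubExponential μ s (fun ω => -q ω) :=
  ⟨h.measurable.neg, by simpa using h.integrable, by simpa using h.integral_le⟩

theorem IsSubExponential.integrable_self {Ω : Type*} [MeasurableSpace Ω] {μ : Measure Ω}
    {q : Ω → ℝ} {s : ℝ} (hs : 0 < s) (h : IsSubExponential μ s q) : Integrable q μ := by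
  refine (h.integrable.const_mul s⁻¹).mono' h.measurable.aestronglyMeasurable
    (ae_of_all _ fun ω => ?_)
  have := Real.add_one_le_exp (s * |q ω|)
  rw [Real.norm_eq_abs, ← div_eq_inv_mul, le_div_iff₀ hs]
  linarith

theorem IsSubExponential.integrable_exp_mul {Ω : Type*} [MeasurableSpace Ω] {μ : Measure Ω}
    {q : Ω → ℝ} {s t : ℝ} (h : IsSubExponential μ s q) (ht : |t| ≤ s) :
    Integrable (fun ω => Real.exp (t * q ω)) μ := by
  have hq := h.measurable
  refine h.integrable.mono' (Measurable.aestronglyMeasurable (by fun_prop))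
    (ae_of_all _ fun ω => ?_)
  rw [Real.norm_of_nonneg (by positivity)]
  refine Real.exp_le_exp.2 ((le_abs_self _).trans ?_)
  rw [abs_mul]
  exact mul_le_mul_of_nonneg_right ht (abs_nonneg _)

/-- Second-order Taylor expansion of exp(tq). With u = s|q|/2, the bounds u² ≤ 2eᵘ and |tq| ≤ u
absorb the remainder into (4t²/s²) exp(s|q|), whose integral is at most 8t²/s². The linear term is
cancelled by the centring through 1 + z ≤ eᶻ. -/
theorem IsSubExponential.integral_exp_mul_le {Ω : Type*} [MeasurableSpace Ω] {μ : Measure Ω}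
    [IsProbabilityMeasure μ] {q : Ω → ℝ} {s t : ℝ} (hs : 0 < s) (h : IsSubExponential μ s q)
    (ht : |t| ≤ s / 2) :
    ∫ ω, Real.exp (t * (q ω - ∫ ω, q ω ∂μ)) ∂μ ≤ Real.exp (8 * t ^ 2 / s ^ 2) := by
  set m := ∫ ω, q ω ∂μ with hm
  have hq := h.integrable_self hs
  have hb : ∀ ω, Real.exp (t * q ω)
      ≤ 1 + t * q ω + 4 * t ^ 2 / s ^ 2 * Real.exp (s * |q ω|) := by
    intro ω
    refine (exp_le_one_add_self_add_sq_mul_exp_abs _).trans ?_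
    set u := s * |q ω| / 2 with hu
    have hu0 : 0 ≤ u := by positivity
    have h1 : u ^ 2 ≤ 2 * Real.exp u := by
      have := Real.quadratic_le_exp_of_nonneg hu0
      linarith
    have h2 : Real.exp |t * q ω| ≤ Real.exp u := by
      refine Real.exp_le_exp.2 ?_
      rw [abs_mul, hu]
      nlinarith [abs_nonneg (q ω)]
    have h3 : Real.exp (s * |q ω|) = Real.exp u * Real.exp u := by
      rw [← Real.exp_add, hu]
      ring_nf
    have h4 : (t * q ω) ^ 2 / 2 = 2 * t ^ 2 / s ^ 2 * u ^ 2 := by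
      rw [hu, div_pow, mul_pow, mul_pow, sq_abs]
      field_simp
    have h5 : (t * q ω) ^ 2 / 2 * Real.exp |t * q ω|
        ≤ 2 * t ^ 2 / s ^ 2 * (2 * Real.exp u) * Real.exp u := by
      rw [h4]
      gcongr
    have h6 : 2 * t ^ 2 / s ^ 2 * (2 * Real.exp u) * Real.exp u
        = 4 * t ^ 2 / s ^ 2 * Real.exp (s * |q ω|) := by
      rw [h3]
      ring
    linarith
  have hi : Integrable (fun ω => 1 + t * q ω) μ := (integrable_const 1).add (hq.const_mul t)
  have hi2 : Integrable (fun ω => 4 * t ^ 2 / s ^ 2 * Real.exp (s * |q ω|)) μ :=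
    h.integrable.const_mul _
  have hE : ∫ ω, Real.exp (t * q ω) ∂μ ≤ 1 + t * m + 8 * t ^ 2 / s ^ 2 := by
    refine (integral_mono (h.integrable_exp_mul (by linarith)) (hi.add hi2) hb).trans ?_
    simp only [Pi.add_apply]
    rw [integral_add hi hi2, integral_add (integrable_const 1) (hq.const_mul t),
      integral_const_mul, integral_const_mul]
    have h7 : 4 * t ^ 2 / s ^ 2 * ∫ ω, Real.exp (s * |q ω|) ∂μ ≤ 4 * t ^ 2 / s ^ 2 * 2 :=
      mul_le_mul_of_nonneg_left h.integral_le (by positivity)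
    have h8 : 4 * t ^ 2 / s ^ 2 * 2 = 8 * t ^ 2 / s ^ 2 := by ring
    simp only [integral_const, probReal_univ, smul_eq_mul, mul_one]
    linarith
  have e : ∀ ω, Real.exp (t * (q ω - m)) = Real.exp (-(t * m)) * Real.exp (t * q ω) := by
    intro ω
    rw [← Real.exp_add]
    ring_nf
  simp_rw [e]
  rw [integral_const_mul]
  calc Real.exp (-(t * m)) * ∫ ω, Real.exp (t * q ω) ∂μ
      ≤ Real.exp (-(t * m)) * Real.exp (t * m + 8 * t ^ 2 / s ^ 2) := by
        refine mul_le_mul_of_nonneg_left (hE.trans ?_) (Real.exp_pos _).le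
        linarith [Real.add_one_le_exp (t * m + 8 * t ^ 2 / s ^ 2)]
    _ = Real.exp (8 * t ^ 2 / s ^ 2) := by
        rw [← Real.exp_add]
        ring_nf

theorem IsSubExponential.measure_sum_ge_le {Ω : Type*} [MeasurableSpace Ω] {μ : Measure Ω}
    [IsProbabilityMeasure μ] {q : Ω → ℝ} {s t : ℝ} (hs : 0 < s) (hs1 : s ≤ 1)
    (h : IsSubExponential μ s q) (ht : 0 ≤ t) (ht8 : t ≤ 8) (n : ℕ) :
    (Measure.pi fun _ : Fin n => μ).real {ω | n * t ≤ ∑ i, (q (ω i) - ∫ ω, q ω ∂μ)}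
      ≤ Real.exp (-(n * (t ^ 2 * s ^ 2 / 32))) := by
  set m := ∫ ω, q ω ∂μ with hm
  set P : Measure (Fin n → Ω) := Measure.pi fun _ : Fin n => μ
  -- The Chernoff parameter minimising −lt + 8l²/s²; the minimum is −t²s²/32. The assumptions t ≤ 8
  -- and s ≤ 1 keep l ≤ s/2, the range of the moment generating function bound.
  set l : ℝ := t * s ^ 2 / 16 with hl
  have hl0 : 0 ≤ l := by positivity
  have hls : |l| ≤ s / 2 := by
    rw [abs_of_nonneg hl0, hl]
    nlinarith [mul_nonneg (sub_nonneg.2 ht8) (sq_nonneg s), mul_nonneg hs.le (sub_nonneg.2 hs1)]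
  have hq := h.measurable
  set f : Fin n → (Fin n → Ω) → ℝ := fun i ω => q (ω i) - m with hf
  have hind : iIndepFun f P := by
    have := iIndepFun_pi (μ := fun _ : Fin n => μ) (X := fun _ : Fin n => fun ω => q ω - m)
      (fun _ => (hq.sub_const m).aemeasurable)
    exact this
  have hfm : ∀ i, Measurable (f i) := fun i => (hq.comp (measurable_pi_apply i)).sub_const m
  have hexp : ∀ i, Integrable (fun ω => Real.exp (l * f i ω)) P := by
    intro i
    have h1 : Integrable (fun ω => Real.exp (l * (q ω - m))) μ := by
      have := (h.integrable_exp_mul (t := l) (by linarith)).mul_const (Real.exp (-(l * m)))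
      refine this.congr (ae_of_all _ fun ω => ?_)
      simp only
      rw [← Real.exp_add]
      ring_nf
    exact (measurePreserving_eval (fun _ : Fin n => μ) i).integrable_comp_of_integrable h1
  have hmgf : ∀ i, mgf (f i) P l ≤ Real.exp (8 * l ^ 2 / s ^ 2) := by
    intro i
    refine le_trans (le_of_eq ?_) (h.integral_exp_mul_le hs hls)
    have hp := measurePreserving_eval (fun _ : Fin n => μ) i
    rw [← hp.map_eq, integral_map hp.measurable.aemeasurable
      (Measurable.aestronglyMeasurable (by fun_prop)), hp.map_eq]
    rfl
  have hsum : (fun ω : Fin n → Ω => ∑ i, (q (ω i) - m)) = ∑ i, f i := by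
    funext ω
    simp [f]
  have hch := measure_ge_le_exp_mul_mgf (μ := P) (X := ∑ i, f i) (n * t) hl0
    (by
      have := hind.integrable_exp_mul_sum (t := l) hfm (s := Finset.univ) fun i _ => hexp i
      simpa using this)
  have e1 : {ω : Fin n → Ω | n * t ≤ ∑ i, (q (ω i) - m)} = {ω | n * t ≤ (∑ i, f i) ω} := by
    rw [← hsum]
  rw [e1]
  refine hch.trans ?_
  rw [hind.mgf_sum hfm]
  calc Real.exp (-l * (n * t)) * ∏ i, mgf (f i) P l
      ≤ Real.exp (-l * (n * t)) * ∏ _i : Fin n, Real.exp (8 * l ^ 2 / s ^ 2) := by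
        refine mul_le_mul_of_nonneg_left ?_ (Real.exp_pos _).le
        exact Finset.prod_le_prod (fun i _ => mgf_nonneg) fun i _ => hmgf i
    _ = Real.exp (-(n * (t ^ 2 * s ^ 2 / 32))) := by
        rw [Finset.prod_const, Finset.card_univ, Fintype.card_fin, ← Real.exp_nat_mul,
          ← Real.exp_add, hl]
        congr 1
        field_simp
        ring

/-- Bernstein's inequality for `n` independent copies of a sub-exponential variable. -/
theorem IsSubExponential.measure_abs_sum_ge_le {Ω : Type*} [MeasurableSpace Ω] {μ : Measure Ω}
    [IsProbabilityMeasure μ] {q : Ω → ℝ} {s t : ℝ} (hs : 0 < s) (hs1 : s ≤ 1)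
    (h : IsSubExponential μ s q) (ht : 0 ≤ t) (ht8 : t ≤ 8) (n : ℕ) :
    (Measure.pi fun _ : Fin n => μ).real {ω | n * t ≤ |∑ i, (q (ω i) - ∫ ω, q ω ∂μ)|}
      ≤ 2 * Real.exp (-(n * (t ^ 2 * s ^ 2 / 32))) := by
  have h1 := h.measure_sum_ge_le hs hs1 ht ht8 n
  have h2 := h.neg.measure_sum_ge_le hs hs1 ht ht8 n
  set P : Measure (Fin n → Ω) := Measure.pi fun _ : Fin n => μ
  have hsub : {ω : Fin n → Ω | n * t ≤ |∑ i, (q (ω i) - ∫ ω, q ω ∂μ)|}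
      ⊆ {ω | n * t ≤ ∑ i, (q (ω i) - ∫ ω, q ω ∂μ)}
        ∪ {ω | n * t ≤ ∑ i, (-q (ω i) - ∫ ω, -q ω ∂μ)} := by
    intro ω hω
    have hω' : n * t ≤ |∑ i, (q (ω i) - ∫ ω, q ω ∂μ)| := hω
    rcases le_abs.1 hω' with h | h
    · exact Or.inl h
    · refine Or.inr (h.trans (le_of_eq ?_))
      rw [integral_neg, ← Finset.sum_neg_distrib]
      exact Finset.sum_congr rfl fun i _ => by ring
  calc P.real _ ≤ P.real _ := measureReal_mono hsub
    _ ≤ _ := measureReal_union_le _ _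
    _ ≤ _ := by linarith

/-! ### Nets of ellipsoids -/

/-- The ball of radius `2` has a `1`-net with at most `5 ^ d` points. -/
theorem exists_finset_net {E : Type*} [NormedAddCommGroup E] [NormedSpace ℝ E]
    [FiniteDimensional ℝ E] :
    ∃ N : Finset E, N.card ≤ 5 ^ Module.finrank ℝ E ∧ (∀ x ∈ N, ‖x‖ ≤ 2) ∧
      ∀ v : E, ‖v‖ ≤ 2 → ∃ x ∈ N, ‖v - x‖ ≤ 1 := by
  classical
  let good : Finset E → Prop := fun s =>
    (∀ c ∈ s, ‖c‖ ≤ 2) ∧ ∀ c ∈ s, ∀ d ∈ s, c ≠ d → 1 ≤ ‖c - d‖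
  have hcard : ∀ s, good s → s.card ≤ 5 ^ Module.finrank ℝ E := fun s hs =>
    Besicovitch.card_le_of_separated s hs.1 hs.2
  -- The cardinality bound provides a 1-separated set of maximal size. It is a net, since a point at
  -- distance more than 1 from all of it could be added.
  let Q : ℕ → Prop := fun k => ∃ s, good s ∧ s.card = k
  have hQ0 : Q 0 := ⟨∅, by simp [good], rfl⟩
  obtain ⟨N, hN, hNk⟩ : Q (Nat.findGreatest Q (5 ^ Module.finrank ℝ E)) :=
    Nat.findGreatest_spec (Nat.zero_le _) hQ0
  refine ⟨N, hcard N hN, hN.1, fun v hv => ?_⟩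
  by_contra! hcon
  have hvN : v ∉ N := fun h => by
    have := hcon v h
    simp only [sub_self, norm_zero] at this
    linarith
  have hgood : good (insert v N) := by
    refine ⟨?_, ?_⟩
    · intro c hc
      rcases Finset.mem_insert.1 hc with rfl | hc
      exacts [hv, hN.1 c hc]
    · intro c hc d hd hcd
      rcases Finset.mem_insert.1 hc with hc | hc <;> rcases Finset.mem_insert.1 hd with hd | hd
      · exact absurd (hc.trans hd.symm) hcd
      · rw [hc]
        exact (hcon d hd).le
      · rw [hd, norm_sub_rev]
        exact (hcon c hc).le
      · exact hN.2 c hc d hd hcd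
  have hle := Nat.le_findGreatest (P := Q) (hcard _ hgood) (⟨_, hgood, rfl⟩ : Q (insert v N).card)
  rw [← hNk, Finset.card_insert_of_notMem hvN] at hle
  omega

/-- The unit ball has a `1 / 4`-net with at most `25 ^ d` points. -/
theorem exists_finset_quarter_net {E : Type*} [NormedAddCommGroup E] [NormedSpace ℝ E]
    [FiniteDimensional ℝ E] :
    ∃ N : Finset E, N.card ≤ 25 ^ Module.finrank ℝ E ∧ (∀ x ∈ N, ‖x‖ ≤ 2) ∧
      ∀ v : E, ‖v‖ ≤ 1 → ∃ x ∈ N, ‖v - x‖ ≤ 1 / 4 := by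
  classical
  obtain ⟨N, hc, hb, hN⟩ := exists_finset_net (E := E)
  -- Two-stage approximation: x approximates 2v within 1, then y approximates the rescaled error
  -- 2(2v − x) within 1.
  refine ⟨Finset.image₂ (fun x y => (1 / 2 : ℝ) • x + (1 / 4 : ℝ) • y) N N, ?_, ?_, ?_⟩
  · refine (Finset.card_image₂_le _ _ _).trans ((Nat.mul_le_mul hc hc).trans (le_of_eq ?_))
    rw [← Nat.mul_pow]
  · intro z hz
    obtain ⟨x, hx, y, hy, rfl⟩ := Finset.mem_image₂.1 hz
    refine (norm_add_le _ _).trans ?_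
    rw [norm_smul, norm_smul]
    norm_num
    linarith [hb x hx, hb y hy]
  · intro v hv
    obtain ⟨x, hx, hvx⟩ := hN ((2 : ℝ) • v) (by rw [norm_smul]; norm_num; linarith)
    obtain ⟨y, hy, hvy⟩ := hN ((2 : ℝ) • ((2 : ℝ) • v - x))
      (by rw [norm_smul]; norm_num; linarith)
    refine ⟨_, Finset.mem_image₂_of_mem hx hy, ?_⟩
    have e : v - ((1 / 2 : ℝ) • x + (1 / 4 : ℝ) • y)
        = (1 / 4 : ℝ) • ((2 : ℝ) • ((2 : ℝ) • v - x) - y) := by module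
    rw [e, norm_smul]
    norm_num
    linarith

/-- A symmetric bilinear form is controlled by its values on a `1 / 4`-net. -/
theorem abs_bilin_le_of_net {E : Type*} [NormedAddCommGroup E] [InnerProductSpace ℝ E]
    [FiniteDimensional ℝ E] (B : LinearMap.BilinForm ℝ E) (hB : ∀ x y, B x y = B y x)
    (hcont : Continuous fun v => B v v) {N : Set E}
    (hN : ∀ v : E, ‖v‖ ≤ 1 → ∃ x ∈ N, ‖v - x‖ ≤ 1 / 4) {t : ℝ} (ht : ∀ x ∈ N, |B x x| ≤ t)
    (v : E) : |B v v| ≤ 4 * t * ‖v‖ ^ 2 := by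
  obtain ⟨w, hw, hmax⟩ := (isCompact_closedBall (0 : E) 1).exists_isMaxOn
    ⟨0, Metric.mem_closedBall_self zero_le_one⟩ (continuous_abs.comp hcont).continuousOn
  set b := |B w w| with hb
  have hw1 : ‖w‖ ≤ 1 := by simpa using hw
  have hball : ∀ x : E, ‖x‖ ≤ 1 → |B x x| ≤ b := fun x hx => hmax (by simpa using hx)
  have hhom : ∀ x : E, |B x x| ≤ b * ‖x‖ ^ 2 := by
    intro x
    by_cases hx : x = 0
    · simp [hx]
    have hn : ‖x‖ ≠ 0 := norm_ne_zero_iff.2 hx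
    have h1 := hball (‖x‖⁻¹ • x) (by rw [norm_smul]; simp [hn])
    rw [LinearMap.BilinForm.smul_left, LinearMap.BilinForm.smul_right, ← mul_assoc, abs_mul,
      abs_of_nonneg (by positivity)] at h1
    have h2 : ‖x‖⁻¹ * ‖x‖⁻¹ * |B x x| * ‖x‖ ^ 2 = |B x x| := by field_simp
    rw [← h2]
    exact mul_le_mul_of_nonneg_right h1 (sq_nonneg _)
  -- Polarisation and the parallelogram law extend the bound from the diagonal to all pairs.
  have hpol : ∀ x y : E, |B x y| ≤ b / 2 * (‖x‖ ^ 2 + ‖y‖ ^ 2) := by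
    intro x y
    have e : B x y = (B (x + y) (x + y) - B (x - y) (x - y)) / 4 := by
      simp only [map_add, map_sub, LinearMap.add_apply, LinearMap.sub_apply, hB y x]
      ring
    have h1 := hhom (x + y)
    have h2 := hhom (x - y)
    have h3 := parallelogram_law_with_norm ℝ x y
    have h4 : b * ‖x + y‖ ^ 2 + b * ‖x - y‖ ^ 2 = 2 * b * (‖x‖ ^ 2 + ‖y‖ ^ 2) := by
      have : ‖x + y‖ ^ 2 + ‖x - y‖ ^ 2 = 2 * (‖x‖ ^ 2 + ‖y‖ ^ 2) := by
        rw [sq, sq, sq, sq]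
        linarith
      rw [← mul_add, this]
      ring
    rw [e, abs_div, abs_of_pos (by norm_num : (0 : ℝ) < 4)]
    have h5 := abs_sub (B (x + y) (x + y)) (B (x - y) (x - y))
    linarith
  obtain ⟨x, hx, hwx⟩ := hN w hw1
  -- By symmetry the difference is B(w − x, w + x). The scaling by 3 and 1/3 balances the norms 1/4
  -- and 9/4, so that b ≤ t + 9b/16 and hence b ≤ 16t/7 ≤ 4t.
  have hdiff : B w w - B x x = B ((3 : ℝ) • (w - x)) ((1 / 3 : ℝ) • (w + x)) := by
    simp only [LinearMap.BilinForm.smul_left, LinearMap.BilinForm.smul_right, map_add, map_sub,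
      LinearMap.sub_apply, hB x w]
    ring
  have h1 := hpol ((3 : ℝ) • (w - x)) ((1 / 3 : ℝ) • (w + x))
  rw [← hdiff, norm_smul, norm_smul] at h1
  have hb0 : 0 ≤ b := abs_nonneg _
  have hsum : ‖w + x‖ ≤ 9 / 4 := by
    have : w + x = (2 : ℝ) • w - (w - x) := by module
    rw [this]
    refine (norm_sub_le _ _).trans ?_
    rw [norm_smul]
    norm_num
    linarith
  have h2 : (‖(3 : ℝ)‖ * ‖w - x‖) ^ 2 + (‖(1 / 3 : ℝ)‖ * ‖w + x‖) ^ 2 ≤ 9 / 8 := by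
    have e1 : ‖w - x‖ ^ 2 ≤ (1 / 4) ^ 2 := pow_le_pow_left₀ (norm_nonneg _) hwx 2
    have e2 : ‖w + x‖ ^ 2 ≤ (9 / 4) ^ 2 := pow_le_pow_left₀ (norm_nonneg _) hsum 2
    norm_num [mul_pow]
    norm_num at e1 e2
    linarith
  have h3 : |B w w - B x x| ≤ b / 2 * (9 / 8) :=
    h1.trans (mul_le_mul_of_nonneg_left h2 (by positivity))
  have h4 : b ≤ t + b / 2 * (9 / 8) := by
    have := abs_sub_abs_le_abs_sub (B w w) (B x x)
    linarith [ht x hx]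
  refine (hhom v).trans (mul_le_mul_of_nonneg_right ?_ (sq_nonneg _))
  linarith

/-- A linear functional is controlled by its values on a `1 / 4`-net. -/
theorem abs_functional_le_of_net {E : Type*} [NormedAddCommGroup E] [InnerProductSpace ℝ E]
    [FiniteDimensional ℝ E] (f : E →ₗ[ℝ] ℝ) {N : Set E}
    (hN : ∀ v : E, ‖v‖ ≤ 1 → ∃ x ∈ N, ‖v - x‖ ≤ 1 / 4) {t : ℝ} (ht : ∀ x ∈ N, |f x| ≤ t)
    (v : E) : |f v| ≤ 2 * t * ‖v‖ := by
  set g := LinearMap.toContinuousLinearMap f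
  have hball : ∀ x : E, ‖x‖ ≤ 1 → |f x| ≤ t + ‖g‖ / 4 := by
    intro x hx
    obtain ⟨y, hy, hxy⟩ := hN x hx
    have h1 := g.le_opNorm (x - y)
    have h2 : g (x - y) = f x - f y := map_sub f x y
    rw [h2, Real.norm_eq_abs] at h1
    have h3 := abs_sub_abs_le_abs_sub (f x) (f y)
    have h4 := mul_le_mul_of_nonneg_left hxy (norm_nonneg g)
    linarith [ht y hy]
  have ht0 : 0 ≤ t := by
    obtain ⟨y, hy, -⟩ := hN 0 (by simp)
    exact (abs_nonneg _).trans (ht y hy)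
  -- Self-bounding: this forces ‖g‖ ≤ 4t/3 ≤ 2t.
  have hg : ‖g‖ ≤ t + ‖g‖ / 4 := by
    refine g.opNorm_le_bound (by positivity) fun x => ?_
    by_cases hx : x = 0
    · simp [hx]
    have hn : ‖x‖ ≠ 0 := norm_ne_zero_iff.2 hx
    have h1 := hball (‖x‖⁻¹ • x) (by rw [norm_smul]; simp [hn])
    rw [map_smul, smul_eq_mul, abs_mul, abs_of_nonneg (by positivity)] at h1
    have h2 : ‖x‖⁻¹ * |f x| * ‖x‖ = |f x| := by field_simp
    change |f x| ≤ _
    rw [← h2]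
    exact mul_le_mul_of_nonneg_right h1 (norm_nonneg _)
  refine (g.le_opNorm v).trans (mul_le_mul_of_nonneg_right ?_ (norm_nonneg _))
  linarith

open scoped MatrixOrder in
theorem exists_isUnit_eq_transpose_mul_self {p : ℕ} {S : Matrix (Fin p) (Fin p) ℝ}
    (hS : S.PosDef) : ∃ R : Matrix (Fin p) (Fin p) ℝ, IsUnit R ∧ S = Rᵀ * R := by
  obtain ⟨R, rfl⟩ := CStarAlgebra.nonneg_iff_eq_star_mul_self.mp hS.posSemidef.nonneg
  refine ⟨R, ?_, by rw [star_eq_conjTranspose, conjTranspose_eq_transpose_of_trivial]⟩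
  exact isUnit_of_mul_isUnit_right hS.isUnit

/-- The ellipsoid `{v | vᵀ S v ≤ 1}` has a net with `25 ^ p` points that controls quadratic forms
and linear functionals. -/
theorem exists_quadratic_net {p : ℕ} {S : Matrix (Fin p) (Fin p) ℝ} (hS : S.PosDef) :
    ∃ N : Finset (Fin p → ℝ), N.card ≤ 25 ^ p ∧ (∀ x ∈ N, x ⬝ᵥ S *ᵥ x ≤ 4) ∧
      (∀ M : Matrix (Fin p) (Fin p) ℝ, Mᵀ = M → ∀ t : ℝ, (∀ x ∈ N, |x ⬝ᵥ M *ᵥ x| ≤ t) →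
        ∀ v, |v ⬝ᵥ M *ᵥ v| ≤ 4 * t * (v ⬝ᵥ S *ᵥ v)) ∧
      (∀ (w : Fin p → ℝ) (t : ℝ), (∀ x ∈ N, |w ⬝ᵥ x| ≤ t) →
        ∀ v, |w ⬝ᵥ v| ≤ 2 * t * √(v ⬝ᵥ S *ᵥ v)) := by
  classical
  obtain ⟨R, hR, rfl⟩ := exists_isUnit_eq_transpose_mul_self hS
  have hRR : R * R⁻¹ = 1 := Matrix.mul_nonsing_inv _ ((Matrix.isUnit_iff_isUnit_det _).1 hR)
  have hRR' : R⁻¹ * R = 1 := Matrix.nonsing_inv_mul _ ((Matrix.isUnit_iff_isUnit_det _).1 hR)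
  let E := EuclideanSpace ℝ (Fin p)
  -- `L` is R⁻¹, which carries the Euclidean unit ball onto the ellipsoid of S = RᵀR. The net is
  -- transported by `L`, and forms and functionals are pulled back along it.
  let L : E →ₗ[ℝ] (Fin p → ℝ) :=
    (Matrix.mulVecLin R⁻¹) ∘ₗ (WithLp.linearEquiv 2 ℝ (Fin p → ℝ)).toLinearMap
  have hL : ∀ x : E, L x = R⁻¹ *ᵥ WithLp.ofLp x := fun x => rfl
  have hLinv : ∀ v : Fin p → ℝ, L (WithLp.toLp 2 (R *ᵥ v)) = v := fun v => by
    rw [hL, Matrix.mulVec_mulVec, hRR', Matrix.one_mulVec]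
  have hq : ∀ v : Fin p → ℝ, v ⬝ᵥ (Rᵀ * R) *ᵥ v = ‖(WithLp.toLp 2 (R *ᵥ v) : E)‖ ^ 2 := by
    intro v
    rw [EuclideanSpace.norm_sq_eq, ← Matrix.mulVec_mulVec, Matrix.dotProduct_mulVec,
      Matrix.vecMul_transpose]
    simp [dotProduct, sq]
  have hLq : ∀ x : E, L x ⬝ᵥ (Rᵀ * R) *ᵥ L x = ‖x‖ ^ 2 := by
    intro x
    rw [hq, hL, Matrix.mulVec_mulVec, hRR, Matrix.one_mulVec]
  obtain ⟨N, hc, hb, hN⟩ := exists_finset_quarter_net (E := E)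
  refine ⟨N.image L, ?_, ?_, ?_, ?_⟩
  · simpa [E] using Finset.card_image_le.trans hc
  · intro x hx
    obtain ⟨y, hy, rfl⟩ := Finset.mem_image.1 hx
    rw [hLq]
    nlinarith [hb y hy, norm_nonneg y]
  · intro M hM t ht v
    let B : LinearMap.BilinForm ℝ E := (Matrix.toBilin' M).comp L L
    have hBv : ∀ x y : E, B x y = L x ⬝ᵥ M *ᵥ L y := fun x y => by
      simp [B, Matrix.toBilin'_apply']
    have hsymm : ∀ x y : E, B x y = B y x := by
      intro x y
      rw [hBv, hBv, Matrix.dotProduct_mulVec, ← Matrix.mulVec_transpose, hM, dotProduct_comm]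
    have hcont : Continuous fun x => B x x := by
      simp_rw [hBv]
      have : Continuous L := L.continuous_of_finiteDimensional
      fun_prop
    have := abs_bilin_le_of_net B hsymm hcont (N := (N : Set E)) (by simpa using hN) (t := t)
      (fun x hx => by
        rw [hBv]
        exact ht _ (Finset.mem_image_of_mem L hx)) (WithLp.toLp 2 (R *ᵥ v))
    rwa [hBv, hLinv, ← hq] at this
  · intro w t ht v
    let f : E →ₗ[ℝ] ℝ := (dotProductBilin ℝ ℝ w) ∘ₗ L
    have hf : ∀ x, f x = w ⬝ᵥ L x := fun x => rfl
    have := abs_functional_le_of_net f (N := (N : Set E)) (by simpa using hN) (t := t)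
      (fun x hx => by
        rw [hf]
        exact ht _ (Finset.mem_image_of_mem L hx)) (WithLp.toLp 2 (R *ᵥ v))
    rw [hf, hLinv] at this
    rwa [hq, Real.sqrt_sq (norm_nonneg _)]

/-! ### Concentration for a linear model -/

/-- A design vector `x` with second moment matrix `S`, a normalized noise `e` uncorrelated with `x`
and a normalized remainder `w`, all sub-Gaussian with variance proxies controlled by `Γ`. -/
structure IsSubGaussianDesign {Ω : Type*} [MeasurableSpace Ω] {p : ℕ} (μ : Measure Ω) (Γ : ℝ)
    (S : Matrix (Fin p) (Fin p) ℝ) (x : Ω → Fin p → ℝ) (e w : Ω → ℝ) : Prop where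
  measurable_x : Measurable x
  measurable_e : Measurable e
  measurable_w : Measurable w
  integral_sq_x : ∀ v, ∫ ω, (x ω ⬝ᵥ v) ^ 2 ∂μ = v ⬝ᵥ S *ᵥ v
  subgaussian_x : ∀ v, HasSubgaussianMGF (fun ω => x ω ⬝ᵥ v) (Real.toNNReal (Γ * (v ⬝ᵥ S *ᵥ v))) μ
  subgaussian_e : HasSubgaussianMGF e (Real.toNNReal Γ) μ
  subgaussian_w : HasSubgaussianMGF w (Real.toNNReal Γ) μ
  integral_x_mul_e : ∀ v, ∫ ω, (x ω ⬝ᵥ v) * e ω ∂μ = 0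
  integral_sq_w : ∫ ω, w ω ^ 2 ∂μ ≤ 1

/-- The sample covariance is comparable to `S`, the empirical correlation of design and noise is
at most `t`, and the remainder has bounded empirical second moment. -/
structure IsGoodSample {n p : ℕ} (S : Matrix (Fin p) (Fin p) ℝ) (t : ℝ) (x : Fin n → Fin p → ℝ)
    (e w : Fin n → ℝ) : Prop where
  cov : ∀ v, |∑ i, (x i ⬝ᵥ v) ^ 2 - n * (v ⬝ᵥ S *ᵥ v)| ≤ n / 2 * (v ⬝ᵥ S *ᵥ v)
  noise : ∀ v, |∑ i, (x i ⬝ᵥ v) * e i| ≤ 2 * (n * t) * √(v ⬝ᵥ S *ᵥ v)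
  remainder : ∑ i, w i ^ 2 ≤ 2 * n

theorem dotProduct_gram_mulVec {n p : ℕ} (x : Matrix (Fin n) (Fin p) ℝ) (v : Fin p → ℝ) :
    v ⬝ᵥ (xᵀ * x) *ᵥ v = ∑ i, (x i ⬝ᵥ v) ^ 2 := by
  rw [← Matrix.mulVec_mulVec, Matrix.dotProduct_mulVec, Matrix.vecMul_transpose]
  simp [dotProduct, sq, Matrix.mulVec]

/-- Bernstein's inequality at each net point and a union bound; the net then extends covariance and
noise control to all directions. The three summands are the failure probabilities for covariance,
noise and remainder. -/
theorem IsSubGaussianDesign.measure_not_isGoodSample_le {Ω : Type*} [MeasurableSpace Ω] {p : ℕ}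
    {μ : Measure Ω} [IsProbabilityMeasure μ] {Γ : ℝ} {S : Matrix (Fin p) (Fin p) ℝ}
    {x : Ω → Fin p → ℝ} {e w : Ω → ℝ} (h : IsSubGaussianDesign μ Γ S x e w) (hS : S.PosDef)
    {s t : ℝ} (hΓ : 0 ≤ Γ) (hs : 0 < s) (hs1 : s ≤ 1) (hsΓ : 16 * Γ * s ≤ 1) (ht : 0 ≤ t)
    (ht8 : t ≤ 8) (n : ℕ) :
    (Measure.pi fun _ : Fin n => μ).real
        {ω | ¬ IsGoodSample S t (fun i => x (ω i)) (fun i => e (ω i)) (fun i => w (ω i))}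
      ≤ 25 ^ p * (2 * Real.exp (-(n * ((1 / 8) ^ 2 * s ^ 2 / 32))))
        + 25 ^ p * (2 * Real.exp (-(n * (t ^ 2 * s ^ 2 / 32))))
        + 2 * Real.exp (-(n * (1 ^ 2 * s ^ 2 / 32))) := by
  set P : Measure (Fin n → Ω) := Measure.pi fun _ : Fin n => μ with hP
  obtain ⟨N, hcard, hN4, hquad, hlin⟩ := exists_quadratic_net hS
  have hxm := h.measurable_x
  have hem := h.measurable_e
  have hwm := h.measurable_w
  have hxv : ∀ v, Measurable fun ω => x ω ⬝ᵥ v := fun v => by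
    simp only [dotProduct]
    fun_prop
  have hx2 : ∀ v ∈ N, IsSubExponential μ s (fun ω => (x ω ⬝ᵥ v) ^ 2) := by
    intro v hv
    have hq0 : 0 ≤ v ⬝ᵥ S *ᵥ v := by simpa using hS.posSemidef.dotProduct_mulVec_nonneg v
    refine isSubExponential_sq (hxv v) (h.subgaussian_x v) hs.le ?_
    rw [Real.coe_toNNReal _ (by positivity)]
    -- Net points satisfy vᵀSv ≤ 4, so the variance proxy is at most 4Γ; this is the origin of the
    -- condition 16Γs ≤ 1.
    nlinarith [mul_le_mul_of_nonneg_left (hN4 v hv) (mul_nonneg hΓ hs.le)]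
  have hsq : ∀ {f : Ω → ℝ}, Measurable f → HasSubgaussianMGF f (Real.toNNReal Γ) μ →
      IsSubExponential μ s (fun ω => f ω ^ 2) := by
    intro f hf hfs
    refine isSubExponential_sq hf hfs hs.le ?_
    rw [Real.coe_toNNReal _ hΓ]
    nlinarith [mul_nonneg hΓ hs.le]
  have hxe : ∀ v ∈ N, IsSubExponential μ s (fun ω => (x ω ⬝ᵥ v) * e ω) := fun v hv =>
    (hx2 v hv).mul_of_sq hs.le (hxv v) hem (hsq hem h.subgaussian_e)
  -- The level 1/8 becomes 1/2 after the net factor 4, the level t becomes 2t after the factor 2,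
  -- and the level 1 is added to a mean of at most 1.
  set A : (Fin p → ℝ) → Set (Fin n → Ω) := fun v =>
    {ω | n * (1 / 8) ≤ |∑ i, ((x (ω i) ⬝ᵥ v) ^ 2 - ∫ ω, (x ω ⬝ᵥ v) ^ 2 ∂μ)|} with hA
  set B : (Fin p → ℝ) → Set (Fin n → Ω) := fun v =>
    {ω | n * t ≤ |∑ i, ((x (ω i) ⬝ᵥ v) * e (ω i) - ∫ ω, (x ω ⬝ᵥ v) * e ω ∂μ)|} with hB
  set D : Set (Fin n → Ω) := {ω | n * 1 ≤ |∑ i, (w (ω i) ^ 2 - ∫ ω, w ω ^ 2 ∂μ)|} with hD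
  have hPA : ∀ v ∈ N, P.real (A v) ≤ 2 * Real.exp (-(n * ((1 / 8) ^ 2 * s ^ 2 / 32))) :=
    fun v hv => (hx2 v hv).measure_abs_sum_ge_le hs hs1 (by norm_num) (by norm_num) n
  have hPB : ∀ v ∈ N, P.real (B v) ≤ 2 * Real.exp (-(n * (t ^ 2 * s ^ 2 / 32))) :=
    fun v hv => (hxe v hv).measure_abs_sum_ge_le hs hs1 ht ht8 n
  have hPD : P.real D ≤ 2 * Real.exp (-(n * (1 ^ 2 * s ^ 2 / 32))) :=
    (hsq hwm h.subgaussian_w).measure_abs_sum_ge_le hs hs1 (by norm_num) (by norm_num) n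
  have hunion : ∀ (F : (Fin p → ℝ) → Set (Fin n → Ω)) (b : ℝ), 0 ≤ b →
      (∀ v ∈ N, P.real (F v) ≤ b) → P.real (⋃ v ∈ N, F v) ≤ 25 ^ p * b := by
    intro F b hb hF
    refine (measureReal_biUnion_finset_le N F).trans ((Finset.sum_le_sum hF).trans ?_)
    rw [Finset.sum_const, nsmul_eq_mul]
    exact mul_le_mul_of_nonneg_right (by exact_mod_cast hcard) hb
  have hsub : {ω | ¬ IsGoodSample S t (fun i => x (ω i)) (fun i => e (ω i)) (fun i => w (ω i))}
      ⊆ ((⋃ v ∈ N, A v) ∪ ⋃ v ∈ N, B v) ∪ D := by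
    intro ω hω
    by_contra hcon
    simp only [Set.mem_union, Set.mem_iUnion, not_or, not_exists] at hcon
    obtain ⟨⟨hωA, hωB⟩, hωD⟩ := hcon
    refine hω ⟨?_, ?_, ?_⟩
    · set X : Matrix (Fin n) (Fin p) ℝ := Matrix.of fun i => x (ω i)
      have hM : ∀ v, v ⬝ᵥ (Xᵀ * X - (n : ℝ) • S) *ᵥ v
          = ∑ i, (x (ω i) ⬝ᵥ v) ^ 2 - n * (v ⬝ᵥ S *ᵥ v) := by
        intro v
        rw [Matrix.sub_mulVec, dotProduct_sub, dotProduct_gram_mulVec, Matrix.smul_mulVec,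
          dotProduct_smul, smul_eq_mul]
        rfl
      intro v
      have hST : Sᵀ = S := by
        rw [← conjTranspose_eq_transpose_of_trivial]
        exact hS.isHermitian
      have := hquad (Xᵀ * X - (n : ℝ) • S)
        (by rw [transpose_sub, transpose_mul, transpose_transpose, transpose_smul, hST])
        (n * (1 / 8)) (fun v hv => by
          rw [hM]
          have h1 := hωA v hv
          simp only [hA, Set.mem_ofPred_eq, not_le, h.integral_sq_x, Finset.sum_sub_distrib,
            Finset.sum_const, Finset.card_univ, Fintype.card_fin, nsmul_eq_mul] at h1
          exact h1.le) v
      rw [hM] at this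
      refine this.trans (le_of_eq ?_)
      ring
    · intro v
      have hM : ∀ v, (∑ i, e (ω i) • x (ω i)) ⬝ᵥ v = ∑ i, (x (ω i) ⬝ᵥ v) * e (ω i) := by
        intro v
        rw [sum_dotProduct]
        refine Finset.sum_congr rfl fun i _ => ?_
        rw [smul_dotProduct, smul_eq_mul, mul_comm]
      have := hlin (∑ i, e (ω i) • x (ω i)) (n * t) (fun v hv => by
          rw [hM]
          have h1 := hωB v hv
          simp only [hB, Set.mem_ofPred_eq, not_le, h.integral_x_mul_e, sub_zero] at h1
          exact h1.le) v
      rwa [hM] at this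
    · simp only [hD, Set.mem_ofPred_eq, not_le, Finset.sum_sub_distrib,
            Finset.sum_const, Finset.card_univ, Fintype.card_fin, nsmul_eq_mul] at hωD
      have h1 := (le_abs_self _).trans hωD.le
      nlinarith [h.integral_sq_w, (Nat.cast_nonneg n : (0 : ℝ) ≤ n)]
  refine (measureReal_mono hsub).trans ((measureReal_union_le _ _).trans ?_)
  refine add_le_add ((measureReal_union_le _ _).trans ?_) hPD
  exact add_le_add (hunion A _ (by positivity) hPA) (hunion B _ (by positivity) hPB)

/-- The constraint gives p ≤ n / log n = o(n), and log n = o(n) too; the threshold does not depend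
on p. -/
theorem exists_forall_add_log_le {η : ℝ} (hη : 0 < η) :
    ∃ N₀ : ℕ, ∀ n : ℕ, N₀ ≤ n → ∀ p : ℕ, (p : ℝ) * Real.log n ≤ n →
      p + Real.log n ≤ η * n := by
  have h1 : ∀ᶠ n : ℕ in Filter.atTop, 2 / η ≤ Real.log n :=
    (Real.tendsto_log_atTop.comp tendsto_natCast_atTop_atTop).eventually_ge_atTop _
  have h2 : ∀ᶠ n : ℕ in Filter.atTop, Real.log n ≤ η / 2 * n := by
    have := (Real.isLittleO_log_id_atTop.comp_tendsto
      (tendsto_natCast_atTop_atTop (R := ℝ))).bound (half_pos hη)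
    filter_upwards [this] with n hn
    simp only [Function.comp, id, Real.norm_eq_abs, Nat.abs_cast] at hn
    exact (le_abs_self _).trans hn
  obtain ⟨N₀, hN⟩ := Filter.eventually_atTop.1 (h1.and h2)
  refine ⟨N₀, fun n hn p hp => ?_⟩
  obtain ⟨h1, h2⟩ := hN n hn
  have h3 : (p : ℝ) * (2 / η) ≤ n := (mul_le_mul_of_nonneg_left h1 (Nat.cast_nonneg p)).trans hp
  have h4 : (p : ℝ) ≤ η / 2 * n := by
    have := mul_le_mul_of_nonneg_left h3 (by positivity : 0 ≤ η / 2)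
    rw [show η / 2 * (p * (2 / η)) = p by field_simp] at this
    exact this
  linarith

theorem twentyfive_pow_le_exp (p : ℕ) : (25 : ℝ) ^ p ≤ Real.exp (4 * p) := by
  rw [mul_comm, Real.exp_nat_mul]
  refine pow_le_pow_left₀ (by norm_num) ?_ p
  have h := Real.exp_one_gt_d9
  rw [show (4 : ℝ) = ((4 : ℕ) : ℝ) * 1 by norm_num, Real.exp_nat_mul]
  calc (25 : ℝ) ≤ 2.7 ^ 4 := by norm_num
    _ ≤ _ := pow_le_pow_left₀ (by norm_num) (by linarith) 4

/-- For `n` large the failure probability is at most `3 / n`, uniformly over `p log n ≤ n`. -/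
theorem exists_forall_failure_le {s T : ℝ} (hs : 0 < s) (hT : T ^ 2 * s ^ 2 = 160) :
    ∃ N₀ : ℕ, ∀ n : ℕ, N₀ ≤ n → 0 < n → ∀ p : ℕ, 1 ≤ p → (p : ℝ) * Real.log n ≤ n →
      T * √((p + Real.log n) / n) ≤ 8 ∧
      25 ^ p * (2 * Real.exp (-(n * ((1 / 8) ^ 2 * s ^ 2 / 32))))
        + 25 ^ p * (2 * Real.exp (-(n * ((T * √((p + Real.log n) / n)) ^ 2 * s ^ 2 / 32))))
        + 2 * Real.exp (-(n * (1 ^ 2 * s ^ 2 / 32))) ≤ 3 / n := by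
  have hT0 : 0 < T ^ 2 := by
    rcases (sq_nonneg T).eq_or_lt with h | h
    · rw [← h] at hT
      norm_num at hT
    · exact h
  -- The first threshold gives t ≤ 8; the second makes the covariance exponent n s²/2048 at least
  -- 5(p + log n).
  obtain ⟨N₀, hN⟩ := exists_forall_add_log_le
    (lt_min (by positivity : 0 < 64 / T ^ 2) (by positivity : 0 < s ^ 2 / 2048 / 5))
  refine ⟨N₀, fun n hn hn0 p hp hpn => ?_⟩
  have hpl := hN n hn p hpn
  have hn0' : (0 : ℝ) < n := by exact_mod_cast hn0
  have hp' : (1 : ℝ) ≤ p := by exact_mod_cast hp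
  have hlog : 0 ≤ Real.log n := Real.log_natCast_nonneg n
  have hη1 : p + Real.log n ≤ 64 / T ^ 2 * n :=
    hpl.trans (mul_le_mul_of_nonneg_right (min_le_left _ _) hn0'.le)
  have hη2 : p + Real.log n ≤ s ^ 2 / 2048 / 5 * n :=
    hpl.trans (mul_le_mul_of_nonneg_right (min_le_right _ _) hn0'.le)
  have hsq : (T * √((p + Real.log n) / n)) ^ 2 = T ^ 2 * ((p + Real.log n) / n) := by
    rw [mul_pow, Real.sq_sqrt (by positivity)]
  have h2e : (2 : ℝ) ≤ Real.exp 1 := by linarith [Real.exp_one_gt_d9]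
  have hinv : Real.exp (-Real.log n) = 1 / n := by
    rw [Real.exp_neg, Real.exp_log hn0', one_div]
  -- Of the exponent 5(p + log n), 4p pays for the net, p ≥ 1 pays for the factor 2 ≤ e, and log n
  -- leaves 1/n. The value 160 = 5 · 32 makes the noise exponent exactly 5(p + log n).
  have hbound : ∀ z : ℝ, 5 * (p + Real.log n) ≤ z →
      25 ^ p * (2 * Real.exp (-z)) ≤ 1 / n := by
    intro z hz
    calc 25 ^ p * (2 * Real.exp (-z))
        ≤ Real.exp (4 * p) * (Real.exp 1 * Real.exp (-z)) := by
          gcongr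
          exact twentyfive_pow_le_exp p
      _ = Real.exp (4 * p + (1 + -z)) := by rw [Real.exp_add, Real.exp_add]
      _ ≤ Real.exp (-Real.log n) := Real.exp_le_exp.2 (by linarith)
      _ = 1 / n := hinv
  refine ⟨?_, ?_⟩
  · refine abs_le_of_sq_le_sq' ?_ (by norm_num) |>.2
    rw [hsq]
    calc T ^ 2 * ((p + Real.log n) / n) ≤ T ^ 2 * (64 / T ^ 2) :=
          mul_le_mul_of_nonneg_left ((div_le_iff₀ hn0').2 hη1) hT0.le
      _ = 8 ^ 2 := by
          rw [mul_div_cancel₀ _ hT0.ne']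
          norm_num
  · have b1 := hbound (n * ((1 / 8) ^ 2 * s ^ 2 / 32)) (by linarith)
    have b2 := hbound (n * ((T * √((p + Real.log n) / n)) ^ 2 * s ^ 2 / 32)) (by
      rw [hsq]
      refine le_of_eq ?_
      have : (n : ℝ) * (T ^ 2 * ((p + Real.log n) / n) * s ^ 2 / 32)
          = (T ^ 2 * s ^ 2) / 32 * (p + Real.log n) := by field_simp
      rw [this, hT]
      norm_num)
    have b3 := hbound (n * (1 ^ 2 * s ^ 2 / 32)) (by nlinarith [sq_nonneg s])
    have b4 : 2 * Real.exp (-(n * (1 ^ 2 * s ^ 2 / 32))) ≤ 1 / n := by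
      refine le_trans ?_ b3
      exact le_mul_of_one_le_left (by positivity) (one_le_pow₀ (by norm_num))
    calc _ ≤ 1 / (n : ℝ) + 1 / n + 1 / n := add_le_add (add_le_add b1 b2) b4
      _ = 3 / n := by ring

/-! ### Least squares on a good sample -/

theorem pinv_eq_inv {p : ℕ} {M : Matrix (Fin p) (Fin p) ℝ} (hM : M.det ≠ 0) : pinv M = M⁻¹ := by
  have h1 : M * M⁻¹ = 1 := Matrix.mul_nonsing_inv _ hM.isUnit
  have h2 : M⁻¹ * M = 1 := Matrix.nonsing_inv_mul _ hM.isUnit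
  refine (isMoorePenrose_pinv M).unique ⟨?_, ?_, ?_, ?_⟩
  · rw [h1, Matrix.one_mul]
  · rw [h2, Matrix.one_mul]
  · rw [h1, transpose_one]
  · rw [h2, transpose_one]

theorem coef_one {n p : ℕ} {X : Matrix (Fin n) (Fin p) ℝ} (hX : (Xᵀ * X).det ≠ 0)
    (y : Fin n → ℝ) : coef X y (1 : Matrix (Fin p) (Fin p) ℝ) = (Xᵀ * X)⁻¹ *ᵥ (Xᵀ *ᵥ y) := by
  rw [coef, transpose_one, Matrix.one_mul, Matrix.mul_one, Matrix.one_mul, Matrix.mul_one,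
    pinv_eq_inv hX, Matrix.mulVec_mulVec]

/-- The Gram matrix dominates nS/2. Hence on good samples the Moore-Penrose inverse is a true
inverse. -/
theorem IsGoodSample.det_ne_zero {n p : ℕ} (hn : 0 < n) {S : Matrix (Fin p) (Fin p) ℝ}
    (hS : S.PosDef) {t : ℝ} {X : Matrix (Fin n) (Fin p) ℝ} {e w : Fin n → ℝ}
    (h : IsGoodSample S t X e w) : (Xᵀ * X).det ≠ 0 := by
  have hn' : (0 : ℝ) < n := by exact_mod_cast hn
  refine (Matrix.PosDef.det_pos (Matrix.PosDef.of_dotProduct_mulVec_pos (isHermitian_gram X)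
    fun v hv => ?_)).ne'
  have h1 : 0 < v ⬝ᵥ S *ᵥ v := by simpa using hS.dotProduct_mulVec_pos hv
  rw [star_trivial, dotProduct_gram_mulVec]
  have h2 := (abs_le.1 (h.cov v)).1
  nlinarith [mul_pos hn' h1]

/-- The normal equations tested against d read ‖Xd‖² = σ⟨Xd, e⟩ − r⟨Xd, w⟩. The first term is
controlled uniformly in d. The second may be correlated with the design, so it is split as ‖Xd‖²/2 +
r²‖w‖²/2 and half of the left side absorbs it. -/
theorem IsGoodSample.estimation_error_le {n p : ℕ} (hn : 0 < n) {S : Matrix (Fin p) (Fin p) ℝ}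
    (hS : S.PosDef) {t σ r : ℝ} (hσ : 0 ≤ σ) {X : Matrix (Fin n) (Fin p) ℝ} {e w : Fin n → ℝ}
    (h : IsGoodSample S t X e w) {a : Fin p → ℝ} {y : Fin n → ℝ}
    (hy : ∀ i, y i = X i ⬝ᵥ a + σ * e i - r * w i) {d : Fin p → ℝ}
    (hd : d = (Xᵀ * X)⁻¹ *ᵥ (Xᵀ *ᵥ y) - a) :
    d ⬝ᵥ S *ᵥ d ≤ 64 * (σ ^ 2 * t ^ 2) + 8 * r ^ 2 := by
  have hn' : (0 : ℝ) < n := by exact_mod_cast hn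
  have hdet := h.det_ne_zero hn hS
  have hnormal : (Xᵀ * X) *ᵥ d = Xᵀ *ᵥ (y - X *ᵥ a) := by
    rw [hd, Matrix.mulVec_sub, Matrix.mulVec_mulVec, Matrix.mul_nonsing_inv _ hdet.isUnit,
      Matrix.one_mulVec, Matrix.mulVec_sub, Matrix.mulVec_mulVec]
  have hkey : ∑ i, (X i ⬝ᵥ d) ^ 2
      = σ * ∑ i, (X i ⬝ᵥ d) * e i - r * ∑ i, (X i ⬝ᵥ d) * w i := by
    rw [← dotProduct_gram_mulVec, hnormal, Matrix.dotProduct_mulVec, Matrix.vecMul_transpose,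
      Finset.mul_sum, Finset.mul_sum, ← Finset.sum_sub_distrib]
    simp only [dotProduct]
    refine Finset.sum_congr rfl fun i _ => ?_
    have h1 : (X *ᵥ d) i = X i ⬝ᵥ d := rfl
    have h2 : (X *ᵥ a) i = X i ⬝ᵥ a := rfl
    rw [h1, Pi.sub_apply, h2, hy i]
    simp only [dotProduct]
    ring
  set q := d ⬝ᵥ S *ᵥ d with hq
  have hq0 : 0 ≤ q := by simpa using hS.posSemidef.dotProduct_mulVec_nonneg d
  set G := ∑ i, (X i ⬝ᵥ d) ^ 2 with hG
  have h1 : n * q / 2 ≤ G := by linarith [(abs_le.1 (h.cov d)).1]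
  have h2 : σ * ∑ i, (X i ⬝ᵥ d) * e i ≤ σ * (2 * (n * t) * √q) :=
    mul_le_mul_of_nonneg_left ((le_abs_self _).trans (h.noise d)) hσ
  have h3 : -(r * ∑ i, (X i ⬝ᵥ d) * w i) ≤ G / 2 + r ^ 2 / 2 * ∑ i, w i ^ 2 := by
    rw [hG, Finset.mul_sum, Finset.mul_sum, Finset.sum_div, ← Finset.sum_neg_distrib,
      ← Finset.sum_add_distrib]
    refine Finset.sum_le_sum fun i _ => ?_
    nlinarith [sq_nonneg (X i ⬝ᵥ d + r * w i)]
  have h4 : r ^ 2 / 2 * ∑ i, w i ^ 2 ≤ r ^ 2 / 2 * (2 * n) :=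
    mul_le_mul_of_nonneg_left h.remainder (by positivity)
  have h5 : (n : ℝ) * (q / 4) ≤ n * (2 * (σ * t) * √q + r ^ 2) := by nlinarith
  have h6 := le_of_mul_le_mul_left h5 hn'
  have h7 : √q ^ 2 = q := Real.sq_sqrt hq0
  -- From q ≤ 8σt√q + 4r² and 8σt√q ≤ q/2 + 32σ²t².
  nlinarith [sq_nonneg (√q - 8 * (σ * t))]

/-! ### Linear algebra -/

theorem dotProduct_mulVec_le_opNorm {p : ℕ} (M : Matrix (Fin p) (Fin p) ℝ) (u : Fin p → ℝ) :
    u ⬝ᵥ M *ᵥ u ≤ opNorm M * (u ⬝ᵥ u) := by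
  set v : EuclideanSpace ℝ (Fin p) := WithLp.toLp 2 u
  set L := (Matrix.toEuclideanLin M).toContinuousLinearMap
  have h1 : inner ℝ v (L v) = u ⬝ᵥ M *ᵥ u := by
    change inner ℝ (WithLp.toLp 2 u) (WithLp.toLp 2 (M *ᵥ u)) = _
    rw [EuclideanSpace.inner_toLp_toLp, star_trivial, dotProduct_comm]
  have h2 : ‖v‖ ^ 2 = u ⬝ᵥ u := by
    rw [EuclideanSpace.norm_sq_eq]
    simp [v, dotProduct, sq]
  calc u ⬝ᵥ M *ᵥ u = inner ℝ v (L v) := h1.symm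
    _ ≤ ‖v‖ * ‖L v‖ := real_inner_le_norm _ _
    _ ≤ ‖v‖ * (‖L‖ * ‖v‖) := mul_le_mul_of_nonneg_left (L.le_opNorm v) (norm_nonneg _)
    _ = opNorm M * (u ⬝ᵥ u) := by
      rw [← h2, opNorm]
      ring

/-- `sortedEigenvalue` takes the default value 0 on non-symmetric matrices, so positivity excludes
them. -/
theorem isHermitian_of_lambdaMin_pos {p : ℕ} [NeZero p] {Q : Matrix (Fin p) (Fin p) ℝ}
    (h : 0 < lambdaMin Q) : Q.IsHermitian := by
  by_contra hQ
  rw [lambdaMin, sortedEigenvalue, dif_neg hQ] at h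
  exact lt_irrefl 0 h

theorem lambdaMin_le_eigenvalues₀ {p : ℕ} [NeZero p] {Q : Matrix (Fin p) (Fin p) ℝ}
    (hQ : Q.IsHermitian) (j : Fin (Fintype.card (Fin p))) : lambdaMin Q ≤ hQ.eigenvalues₀ j := by
  rw [lambdaMin, sortedEigenvalue, dif_pos hQ]
  refine hQ.eigenvalues₀_antitone ?_
  have hj := j.2
  rw [Fin.le_def]
  simp only [Fintype.card_fin] at hj
  simp only [Fin.val_cast, Fin.val_rev, Fin.val_zero]
  omega

theorem posDef_of_lambdaMin_pos {p : ℕ} [NeZero p] {Q : Matrix (Fin p) (Fin p) ℝ}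
    (h : 0 < lambdaMin Q) : Q.PosDef := by
  have hQ := isHermitian_of_lambdaMin_pos h
  rw [hQ.posDef_iff_eigenvalues_pos]
  exact fun i => h.trans_le (lambdaMin_le_eigenvalues₀ hQ _)

/-- The only property of κ that the risk bound uses. -/
theorem one_le_condNumber {p : ℕ} [NeZero p] {Q : Matrix (Fin p) (Fin p) ℝ}
    (h : 0 < lambdaMin Q) : 1 ≤ condNumber Q := by
  have hQ := isHermitian_of_lambdaMin_pos h
  rw [condNumber, one_le_div h]
  refine (lambdaMin_le_eigenvalues₀ hQ (Fin.cast (Fintype.card_fin p).symm 0)).trans (le_of_eq ?_)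
  rw [lambdaMax, sortedEigenvalue, dif_pos hQ]

theorem isUnit_det_gram_of_rank {p K : ℕ} {A : Matrix (Fin p) (Fin K) ℝ} (hA : A.rank = K) :
    IsUnit (Aᵀ * A).det := by
  have hinj : Function.Injective A.mulVec := by
    have h1 := A.mulVecLin.finrank_range_add_finrank_ker
    rw [Matrix.rank] at hA
    rw [hA, Module.finrank_fintype_fun_eq_card, Fintype.card_fin] at h1
    have h2 : Module.finrank ℝ (LinearMap.ker A.mulVecLin) = 0 := by omega
    have h3 := LinearMap.ker_eq_bot.1 (Submodule.finrank_eq_zero.1 h2)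
    exact h3
  have := Matrix.PosDef.conjTranspose_mul_self A hinj
  rw [conjTranspose_eq_transpose_of_trivial] at this
  exact this.det_pos.ne'.isUnit

/-- The vector `a = A (Aᵀ A)⁻¹ β` solves `Aᵀ a = β` with `‖a‖² = βᵀ (Aᵀ A)⁻¹ β`. -/
theorem exists_transpose_mulVec_eq {p K : ℕ} {A : Matrix (Fin p) (Fin K) ℝ} (hA : A.rank = K)
    (β : Fin K → ℝ) :
    ∃ a : Fin p → ℝ, Aᵀ *ᵥ a = β ∧ a ⬝ᵥ a = β ⬝ᵥ ((Aᵀ * A)⁻¹ *ᵥ β) := by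
  have hu := isUnit_det_gram_of_rank hA
  have h1 : Aᵀ *ᵥ (A *ᵥ ((Aᵀ * A)⁻¹ *ᵥ β)) = β := by
    rw [Matrix.mulVec_mulVec, Matrix.mulVec_mulVec, Matrix.mul_nonsing_inv _ hu, Matrix.one_mulVec]
  refine ⟨A *ᵥ ((Aᵀ * A)⁻¹ *ᵥ β), h1, ?_⟩
  rw [Matrix.dotProduct_mulVec, ← Matrix.mulVec_transpose, h1]

/-! ### Moments of linear combinations -/

theorem HasSecondMoment.memLp_dotProduct {Ω : Type*} [MeasurableSpace Ω] {d : ℕ} {μ : Measure Ω}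
    {x : Ω → Fin d → ℝ} {S : Matrix (Fin d) (Fin d) ℝ} (h : HasSecondMoment μ x S)
    (u : Fin d → ℝ) : MemLp (fun ω => x ω ⬝ᵥ u) 2 μ := by
  have := (LinearMap.toContinuousLinearMap
    ((dotProductBilin ℝ ℝ u : (Fin d → ℝ) →ₗ[ℝ] ℝ))).comp_memLp' h.memLp
  refine this.ae_eq (ae_of_all _ fun ω => ?_)
  exact dotProduct_comm u (x ω)

theorem HasSecondMoment.memLp_apply {Ω : Type*} [MeasurableSpace Ω] {d : ℕ} {μ : Measure Ω}
    {x : Ω → Fin d → ℝ} {S : Matrix (Fin d) (Fin d) ℝ} (h : HasSecondMoment μ x S)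
    (i : Fin d) : MemLp (fun ω => x ω i) 2 μ := by
  classical
  simpa using h.memLp_dotProduct (Pi.single i 1)

theorem HasSecondMoment.integral_dotProduct {Ω : Type*} [MeasurableSpace Ω] {d : ℕ}
    {μ : Measure Ω} [IsProbabilityMeasure μ] {x : Ω → Fin d → ℝ} {S : Matrix (Fin d) (Fin d) ℝ}
    (h : HasSecondMoment μ x S) (u : Fin d → ℝ) : ∫ ω, x ω ⬝ᵥ u ∂μ = 0 := by
  simp only [dotProduct]
  rw [integral_finsetSum _ fun i _ =>
    ((h.memLp_apply i).integrable (by norm_num)).mul_const (u i)]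
  refine Finset.sum_eq_zero fun i _ => ?_
  rw [integral_mul_const, h.mean_zero, zero_mul]

theorem HasSecondMoment.integral_dotProduct_sq {Ω : Type*} [MeasurableSpace Ω] {d : ℕ}
    {μ : Measure Ω} {x : Ω → Fin d → ℝ} {S : Matrix (Fin d) (Fin d) ℝ}
    (h : HasSecondMoment μ x S) (u : Fin d → ℝ) :
    ∫ ω, (x ω ⬝ᵥ u) ^ 2 ∂μ = u ⬝ᵥ S *ᵥ u := by
  have hint : ∀ i j, Integrable (fun ω => u i * u j * (x ω i * x ω j)) μ := fun i j =>
    ((h.memLp_apply i).integrable_mul (h.memLp_apply j)).const_mul (u i * u j)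
  have e : ∀ ω, (x ω ⬝ᵥ u) ^ 2 = ∑ i, ∑ j, u i * u j * (x ω i * x ω j) := by
    intro ω
    rw [sq, dotProduct, Finset.sum_mul_sum]
    refine Finset.sum_congr rfl fun i _ => Finset.sum_congr rfl fun j _ => ?_
    ring
  simp_rw [e]
  rw [integral_finsetSum _ fun i _ => integrable_finsetSum _ fun j _ => hint i j, dotProduct]
  refine Finset.sum_congr rfl fun i _ => ?_
  rw [integral_finsetSum _ fun j _ => hint i j, Matrix.mulVec, dotProduct, Finset.mul_sum]
  refine Finset.sum_congr rfl fun j _ => ?_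
  rw [integral_const_mul, h.second_moment]
  ring

theorem hasSubgaussianMGF_mono {Ω : Type*} [MeasurableSpace Ω] {μ : Measure Ω} {x : Ω → ℝ}
    {c c' : NNReal} (h : HasSubgaussianMGF x c μ) (hc : c ≤ c') : HasSubgaussianMGF x c' μ := by
  refine ⟨h.integrable_exp_mul, fun t => (h.mgf_le t).trans (Real.exp_le_exp.2 ?_)⟩
  have : (c : ℝ) ≤ c' := hc
  gcongr

theorem hasSubgaussianMGF_const_mul {Ω : Type*} [MeasurableSpace Ω] {μ : Measure Ω}
    {x : Ω → ℝ} {c c' r : ℝ} (h : HasSubgaussianMGF x c.toNNReal μ) (hc : 0 ≤ c)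
    (hcc : r ^ 2 * c ≤ c') : HasSubgaussianMGF (fun ω => r * x ω) c'.toNNReal μ := by
  refine hasSubgaussianMGF_mono (h.const_mul r) ?_
  rw [← NNReal.coe_le_coe, Real.coe_toNNReal _ ((by positivity : 0 ≤ r ^ 2 * c).trans hcc)]
  refine le_trans (le_of_eq ?_) hcc
  change r ^ 2 * ((c.toNNReal : NNReal) : ℝ) = _
  rw [Real.coe_toNNReal _ hc]

theorem IsColoredSubGaussian.hasSubgaussianMGF_dotProduct {Ω : Type*} [MeasurableSpace Ω] {d : ℕ}
    {μ : Measure Ω} [IsProbabilityMeasure μ] {γ : ℝ} {x : Ω → Fin d → ℝ}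
    {S : Matrix (Fin d) (Fin d) ℝ} (h : IsColoredSubGaussian μ γ S x)
    (hx : HasSecondMoment μ x S) (u : Fin d → ℝ) :
    HasSubgaussianMGF (fun ω => x ω ⬝ᵥ u) (Real.toNNReal (γ ^ 2 * (u ⬝ᵥ S *ᵥ u))) μ := by
  obtain ⟨x', hx', hsg, hae⟩ := h
  set z : Fin d → ℝ := (sqrtMatrix S)ᵀ *ᵥ u with hz
  have hxz : (fun ω => x' ω ⬝ᵥ z) =ᵐ[μ] fun ω => x ω ⬝ᵥ u := by
    filter_upwards [hae] with ω hω
    rw [hω, hz, Matrix.mulVec_transpose, dotProduct_comm, ← Matrix.dotProduct_mulVec,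
      dotProduct_comm]
  -- Both sides are the second moment of the same variable, so no property of `sqrtMatrix` is
  -- needed.
  have hzz : z ⬝ᵥ z = u ⬝ᵥ S *ᵥ u := by
    have h1 := hx'.integral_dotProduct_sq z
    rw [Matrix.one_mulVec] at h1
    rw [← hx.integral_dotProduct_sq, ← h1]
    refine integral_congr_ae ?_
    filter_upwards [hxz] with ω hω
    rw [hω]
  rw [← hzz]
  refine HasSubgaussianMGF.congr ?_ hxz
  by_cases hz0 : z = 0
  · simp [hz0, HasSubgaussianMGF.fun_zero]
  have hpos : 0 < z ⬝ᵥ z := by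
    have := (dotProduct_star_self_pos_iff (v := z)).2 hz0
    simpa using this
  set r := √(z ⬝ᵥ z) with hr
  have hr0 : r ≠ 0 := (Real.sqrt_pos.2 hpos).ne'
  have hr2 : r ^ 2 = z ⬝ᵥ z := Real.sq_sqrt hpos.le
  have hunit : (r⁻¹ • z) ⬝ᵥ (r⁻¹ • z) = 1 := by
    rw [smul_dotProduct, dotProduct_smul, ← hr2]
    simp only [smul_eq_mul]
    field_simp
  have h1 := hasSubgaussianMGF_const_mul (r := r) (c' := γ ^ 2 * (z ⬝ᵥ z))
    (hsg _ hunit).subgaussian (sq_nonneg γ) (by rw [hr2, mul_comm])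
  refine h1.congr (ae_of_all _ fun ω => ?_)
  simp only [dotProduct_smul, smul_eq_mul]
  field_simp

/-! ### The factor regression model as a linear model -/

/-- Allows normalisation by the standard deviation even when σ or the remainder vanishes: a variable
with zero second moment is zero almost everywhere, which agrees with 0⁻¹ = 0. -/
theorem ae_sqrt_mul_inv_mul_eq {Ω : Type*} [MeasurableSpace Ω] {μ : Measure Ω} {f : Ω → ℝ} {m : ℝ}
    (hf : MemLp f 2 μ) (hm : ∫ ω, f ω ^ 2 ∂μ = m) :
    ∀ᵐ ω ∂μ, √m * ((√m)⁻¹ * f ω) = f ω := by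
  have hm0 : 0 ≤ m := hm ▸ integral_nonneg fun ω => sq_nonneg _
  by_cases h0 : √m = 0
  · have hm' : ∫ ω, f ω ^ 2 ∂μ = 0 := by rw [hm, ← Real.sq_sqrt hm0, h0]; norm_num
    rw [integral_eq_zero_iff_of_nonneg (fun ω => sq_nonneg _) hf.integrable_sq] at hm'
    filter_upwards [hm'] with ω hω
    have : f ω = 0 := by simpa using hω
    simp [this]
  · exact ae_of_all _ fun ω => by field_simp

theorem inv_sqrt_sq_mul_le_one {m : ℝ} (hm : 0 ≤ m) : (√m)⁻¹ ^ 2 * m ≤ 1 := by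
  rw [inv_pow, Real.sq_sqrt hm]
  exact inv_mul_le_one

theorem integral_mul_eq_zero_of_indepFun {Ω : Type*} [MeasurableSpace Ω] {μ : Measure Ω}
    {f g : Ω → ℝ} (h : IndepFun f g μ) (hf : Measurable f) (hg : Measurable g)
    (h0 : ∫ ω, g ω ∂μ = 0) : ∫ ω, f ω * g ω ∂μ = 0 := by
  rw [h.integral_fun_mul_eq_mul_integral hf.aestronglyMeasurable hg.aestronglyMeasurable, h0,
    mul_zero]

/-- In the factor regression model, `Y = Xᵀ a + σ e - r w` with `a = A (Aᵀ A)⁻¹ β`, where `e` is the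
normalized noise and `r w = Wᵀ a`. -/
theorem IsSubGaussianFRM.exists_design {Ω : Type*} [MeasurableSpace Ω] {μ : Measure Ω}
    [IsProbabilityMeasure μ] {p : ℕ} {γε γw γz Γ : ℝ} {θ : Param p} {Xs : Ω → Fin p → ℝ}
    {Ys : Ω → ℝ} (h : IsSubGaussianFRM γε γw γz μ θ Xs Ys) (hW : θ.SigmaW.PosDef)
    (hε : γε ^ 2 ≤ Γ) (hw : γw ^ 2 ≤ Γ) (hz : γz ^ 2 ≤ Γ) :
    0 ≤ θ.sigmaSq ∧
    ∃ (S : Matrix (Fin p) (Fin p) ℝ) (a : Fin p → ℝ) (x : Ω → Fin p → ℝ) (e w : Ω → ℝ) (r : ℝ),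
      S.PosDef ∧ IsSubGaussianDesign μ Γ S x e w ∧ Xs =ᵐ[μ] x ∧
      (Ys =ᵐ[μ] fun ω => x ω ⬝ᵥ a + √θ.sigmaSq * e ω - r * w ω) ∧
      r ^ 2 ≤ opNorm θ.SigmaW * (θ.β ⬝ᵥ ((θ.Aᵀ * θ.A)⁻¹ *ᵥ θ.β)) ∧
      ∀ α : Fin p → ℝ, ∫ ω, (Ys ω - Xs ω ⬝ᵥ α) ^ 2 ∂μ
        ≤ θ.sigmaSq + 2 * ((α - a) ⬝ᵥ S *ᵥ (α - a)) + 2 * r ^ 2 := by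
  obtain ⟨Z, W, ε, hF, hεsg, hZsg, hWsg⟩ := h
  have hΓ : 0 ≤ Γ := (sq_nonneg _).trans hε
  have hσ0 : 0 ≤ θ.sigmaSq := hF.second_moment_ε ▸ integral_nonneg fun ω => sq_nonneg _
  obtain ⟨a, hAa, haa⟩ := exists_transpose_mulVec_eq hF.rank_A θ.β
  have hZm := hF.moments_Z.measurable
  have hWm := hF.moments_W.measurable
  have hεm := hF.measurable_ε
  have hZε : IndepFun Z ε μ := hF.indep_Z.comp measurable_id measurable_snd
  have hZW : IndepFun Z W μ := hF.indep_Z.comp measurable_id measurable_fst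
  have hdot : ∀ {d : ℕ} (u : Fin d → ℝ), Measurable fun y : Fin d → ℝ => y ⬝ᵥ u := by
    intro d u
    simp only [dotProduct]
    fun_prop
  set S : Matrix (Fin p) (Fin p) ℝ := θ.A * θ.SigmaZ * θ.Aᵀ + θ.SigmaW with hS
  have hSv : ∀ v, v ⬝ᵥ S *ᵥ v
      = (θ.Aᵀ *ᵥ v) ⬝ᵥ θ.SigmaZ *ᵥ (θ.Aᵀ *ᵥ v) + v ⬝ᵥ θ.SigmaW *ᵥ v := by
    intro v
    rw [hS, Matrix.add_mulVec, dotProduct_add, ← Matrix.mulVec_mulVec, ← Matrix.mulVec_mulVec,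
      Matrix.dotProduct_mulVec v θ.A, ← Matrix.mulVec_transpose]
  have hZ0 : ∀ u, 0 ≤ u ⬝ᵥ θ.SigmaZ *ᵥ u := fun u => by
    rw [← hF.moments_Z.integral_dotProduct_sq]
    exact integral_nonneg fun ω => sq_nonneg _
  have hW0 : ∀ u, 0 ≤ u ⬝ᵥ θ.SigmaW *ᵥ u := fun u => by
    rw [← hF.moments_W.integral_dotProduct_sq]
    exact integral_nonneg fun ω => sq_nonneg _
  have hSpd : S.PosDef := by
    refine Matrix.PosDef.of_dotProduct_mulVec_pos ?_ fun v hv => ?_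
    · have hZT : θ.SigmaZᵀ = θ.SigmaZ := by
        ext i j
        rw [transpose_apply, ← hF.moments_Z.second_moment, ← hF.moments_Z.second_moment]
        simp_rw [mul_comm]
      have hWT : θ.SigmaWᵀ = θ.SigmaW := by
        rw [← conjTranspose_eq_transpose_of_trivial]
        exact hW.isHermitian
      rw [Matrix.IsHermitian, conjTranspose_eq_transpose_of_trivial, hS, transpose_add,
        transpose_mul, transpose_mul, transpose_transpose, hZT, hWT, Matrix.mul_assoc]
    · rw [star_trivial, hSv]
      have h1 : 0 < v ⬝ᵥ θ.SigmaW *ᵥ v := by simpa using hW.dotProduct_mulVec_pos hv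
      linarith [hZ0 (θ.Aᵀ *ᵥ v)]
  -- A measurable version of `Xs`, which is only known to agree with it almost everywhere.
  set x : Ω → Fin p → ℝ := fun ω => θ.A *ᵥ Z ω + W ω with hx
  have hxv : ∀ v ω, x ω ⬝ᵥ v = Z ω ⬝ᵥ (θ.Aᵀ *ᵥ v) + W ω ⬝ᵥ v := by
    intro v ω
    rw [hx, add_dotProduct, Matrix.mulVec_transpose, dotProduct_comm, Matrix.dotProduct_mulVec,
      dotProduct_comm (Z ω)]
  have hxm : Measurable x := by
    have : Measurable fun z : Fin θ.K → ℝ => θ.A *ᵥ z :=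
      Continuous.measurable (by fun_prop)
    exact (this.comp hZm).add hWm
  have hZL := fun v => hF.moments_Z.memLp_dotProduct (θ.Aᵀ *ᵥ v)
  have hWL := hF.moments_W.memLp_dotProduct
  have hxL : ∀ v, MemLp (fun ω => x ω ⬝ᵥ v) 2 μ := fun v => by
    simp_rw [hxv]
    exact (hZL v).add (hWL v)
  have hZε0 : ∀ u, ∫ ω, (Z ω ⬝ᵥ u) * ε ω ∂μ = 0 := fun u =>
    integral_mul_eq_zero_of_indepFun (hZε.comp (hdot u) measurable_id) ((hdot u).comp hZm) hεm
      hF.mean_ε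
  have hWε0 : ∀ u, ∫ ω, (W ω ⬝ᵥ u) * ε ω ∂μ = 0 := fun u =>
    integral_mul_eq_zero_of_indepFun (hF.indep_W.comp (hdot u) measurable_id) ((hdot u).comp hWm)
      hεm hF.mean_ε
  have hZW0 : ∀ u v, ∫ ω, (Z ω ⬝ᵥ u) * (W ω ⬝ᵥ v) ∂μ = 0 := fun u v =>
    integral_mul_eq_zero_of_indepFun (hZW.comp (hdot u) (hdot v)) ((hdot u).comp hZm)
      ((hdot v).comp hWm) (hF.moments_W.integral_dotProduct v)
  have hxε0 : ∀ v, ∫ ω, (x ω ⬝ᵥ v) * ε ω ∂μ = 0 := fun v => by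
    have i1 : Integrable (fun ω => (Z ω ⬝ᵥ (θ.Aᵀ *ᵥ v)) * ε ω) μ :=
      (hZL v).integrable_mul hF.memLp_ε
    have i2 : Integrable (fun ω => (W ω ⬝ᵥ v) * ε ω) μ := (hWL v).integrable_mul hF.memLp_ε
    simp_rw [hxv, add_mul]
    rw [integral_add i1 i2, hZε0, hWε0, add_zero]
  have hx2 : ∀ v, ∫ ω, (x ω ⬝ᵥ v) ^ 2 ∂μ = v ⬝ᵥ S *ᵥ v := fun v => by
    have e : ∀ ω, (x ω ⬝ᵥ v) ^ 2 = (Z ω ⬝ᵥ (θ.Aᵀ *ᵥ v)) ^ 2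
        + 2 * ((Z ω ⬝ᵥ (θ.Aᵀ *ᵥ v)) * (W ω ⬝ᵥ v)) + (W ω ⬝ᵥ v) ^ 2 := fun ω => by
      rw [hxv]
      ring
    have i1 : Integrable (fun ω => 2 * ((Z ω ⬝ᵥ (θ.Aᵀ *ᵥ v)) * (W ω ⬝ᵥ v))) μ :=
      ((hZL v).integrable_mul (hWL v)).const_mul 2
    have i2 : Integrable (fun ω => (Z ω ⬝ᵥ (θ.Aᵀ *ᵥ v)) ^ 2
        + 2 * ((Z ω ⬝ᵥ (θ.Aᵀ *ᵥ v)) * (W ω ⬝ᵥ v))) μ := (hZL v).integrable_sq.add i1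
    simp_rw [e]
    rw [integral_add i2 (hWL v).integrable_sq,
      integral_add (hZL v).integrable_sq i1, integral_const_mul, hZW0,
      hF.moments_Z.integral_dotProduct_sq, hF.moments_W.integral_dotProduct_sq, hSv]
    ring
  have hxsg : ∀ v, HasSubgaussianMGF (fun ω => x ω ⬝ᵥ v)
      (Real.toNNReal (Γ * (v ⬝ᵥ S *ᵥ v))) μ := fun v => by
    have hs := (hZsg.hasSubgaussianMGF_dotProduct hF.moments_Z (θ.Aᵀ *ᵥ v)).add_of_indepFun
      (hWsg.hasSubgaussianMGF_dotProduct hF.moments_W v) (hZW.comp (hdot _) (hdot v))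
    refine hasSubgaussianMGF_mono (hs.congr (ae_of_all _ fun ω => (hxv v ω).symm)) ?_
    have z0 := hZ0 (θ.Aᵀ *ᵥ v)
    have w0 := hW0 v
    rw [← Real.toNNReal_add (by positivity) (by positivity), hSv, mul_add]
    exact Real.toNNReal_le_toNNReal (add_le_add (mul_le_mul_of_nonneg_right hz z0)
      (mul_le_mul_of_nonneg_right hw w0))
  set m := a ⬝ᵥ θ.SigmaW *ᵥ a with hm
  have hWa2 : ∫ ω, (W ω ⬝ᵥ a) ^ 2 ∂μ = m := hF.moments_W.integral_dotProduct_sq a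
  have hm0 : 0 ≤ m := hW0 a
  have hr2 : √m ^ 2 = m := Real.sq_sqrt hm0
  have hs2 : √θ.sigmaSq ^ 2 = θ.sigmaSq := Real.sq_sqrt hσ0
  have hXae : Xs =ᵐ[μ] x := hF.eq_X
  have hYae : Ys =ᵐ[μ] fun ω => x ω ⬝ᵥ a + ε ω - W ω ⬝ᵥ a := by
    filter_upwards [hF.eq_Y] with ω hω
    rw [hω, hxv, hAa]
    ring
  refine ⟨hσ0, S, a, x, fun ω => (√θ.sigmaSq)⁻¹ * ε ω, fun ω => (√m)⁻¹ * (W ω ⬝ᵥ a), √m, hSpd,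
    ⟨hxm, hεm.const_mul _, ((hdot a).comp hWm).const_mul _, hx2, hxsg, ?_, ?_, ?_, ?_⟩, hXae, ?_,
    ?_, ?_⟩
  · refine hasSubgaussianMGF_const_mul hεsg.subgaussian (sq_nonneg _) ?_
    rw [mul_pow, hs2, ← mul_assoc]
    exact (mul_le_of_le_one_left (sq_nonneg _) (inv_sqrt_sq_mul_le_one hσ0)).trans hε
  · refine hasSubgaussianMGF_const_mul
      (hWsg.hasSubgaussianMGF_dotProduct hF.moments_W a) (by positivity) ?_
    rw [mul_left_comm]
    exact (mul_le_of_le_one_right (sq_nonneg _) (inv_sqrt_sq_mul_le_one hm0)).trans hw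
  · intro v
    simp_rw [mul_left_comm]
    rw [integral_const_mul, hxε0, mul_zero]
  · simp_rw [mul_pow]
    rw [integral_const_mul, hWa2]
    exact inv_sqrt_sq_mul_le_one hm0
  · filter_upwards [hYae, ae_sqrt_mul_inv_mul_eq hF.memLp_ε hF.second_moment_ε,
      ae_sqrt_mul_inv_mul_eq (hWL a) hWa2] with ω h1 h2 h3
    rw [h1, h2, h3]
  · rw [hr2, hm, ← haa]
    exact dotProduct_mulVec_le_opNorm _ _
  · intro α
    set d := α - a with hd
    have i1 : Integrable (fun ω => ε ω ^ 2) μ := hF.memLp_ε.integrable_sq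
    have i2 : Integrable (fun ω => 2 * ((W ω ⬝ᵥ a) * ε ω)) μ :=
      ((hWL a).integrable_mul hF.memLp_ε).const_mul 2
    have i3 : Integrable (fun ω => 2 * ((x ω ⬝ᵥ d) * ε ω)) μ :=
      ((hxL d).integrable_mul hF.memLp_ε).const_mul 2
    have i4 : Integrable (fun ω => 2 * (x ω ⬝ᵥ d) ^ 2) μ := (hxL d).integrable_sq.const_mul 2
    have i5 : Integrable (fun ω => 2 * (W ω ⬝ᵥ a) ^ 2) μ := (hWL a).integrable_sq.const_mul 2
    have i12 : Integrable (fun ω => ε ω ^ 2 - 2 * ((W ω ⬝ᵥ a) * ε ω)) μ := i1.sub i2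
    have i13 : Integrable (fun ω => ε ω ^ 2 - 2 * ((W ω ⬝ᵥ a) * ε ω)
        - 2 * ((x ω ⬝ᵥ d) * ε ω)) μ := i12.sub i3
    have i14 : Integrable (fun ω => ε ω ^ 2 - 2 * ((W ω ⬝ᵥ a) * ε ω)
        - 2 * ((x ω ⬝ᵥ d) * ε ω) + 2 * (x ω ⬝ᵥ d) ^ 2) μ := i13.add i4
    -- The residual is ε − Wᵀa − xᵀd. The cross terms with ε are kept because they integrate to
    -- zero, so σ² appears with constant 1; the rest uses (u + v)² ≤ 2u² + 2v².
    have hle : ∀ᵐ ω ∂μ, (Ys ω - Xs ω ⬝ᵥ α) ^ 2 ≤ ε ω ^ 2 - 2 * ((W ω ⬝ᵥ a) * ε ω)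
        - 2 * ((x ω ⬝ᵥ d) * ε ω) + 2 * (x ω ⬝ᵥ d) ^ 2 + 2 * (W ω ⬝ᵥ a) ^ 2 := by
      filter_upwards [hXae, hYae] with ω h1 h2
      have h3 : x ω ⬝ᵥ α = x ω ⬝ᵥ a + x ω ⬝ᵥ d := by
        rw [hd, ← dotProduct_add, add_sub_cancel]
      rw [h1, h2, h3]
      nlinarith [sq_nonneg (W ω ⬝ᵥ a - x ω ⬝ᵥ d)]
    refine (integral_mono_of_nonneg (ae_of_all _ fun ω => sq_nonneg _)
      (i14.add i5) hle).trans (le_of_eq ?_)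
    simp only [Pi.add_apply]
    rw [integral_add i14 i5, integral_add i13 i4, integral_sub i12 i3, integral_sub i1 i2, integral_const_mul, integral_const_mul,
      integral_const_mul, integral_const_mul, hWε0, hxε0, hx2, hWa2, hF.second_moment_ε, hr2]
    ring

/-! ### Transfer to the sample space -/

/-- The law of the sample is the product of the laws of the observations. -/
theorem IsIIDSample.map_eq {Ω Ω₀ : Type*} [MeasurableSpace Ω] [MeasurableSpace Ω₀] {n p : ℕ}
    {P : Measure Ω} [IsProbabilityMeasure P] {μ : Measure Ω₀} [IsProbabilityMeasure μ]
    {X : Fin n → Ω → Fin p → ℝ}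
    {Y : Fin n → Ω → ℝ} {X₀ : Ω₀ → Fin p → ℝ} {Y₀ : Ω₀ → ℝ} (h : IsIIDSample P μ X Y X₀ Y₀)
    {x : Ω₀ → Fin p → ℝ} {y : Ω₀ → ℝ} (hx : X₀ =ᵐ[μ] x) (hy : Y₀ =ᵐ[μ] y) (hxm : Measurable x)
    (hym : Measurable y) :
    P.map (fun ω i => (X i ω, Y i ω))
      = (Measure.pi fun _ : Fin n => μ).map (fun ω i => (x (ω i), y (ω i))) := by
  have h1 := (iIndepFun_iff_map_fun_eq_pi_map fun i => (h.ident i).aemeasurable_fst).1 h.indep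
  have h2 : ∀ i, P.map (fun ω => (X i ω, Y i ω)) = μ.map (fun ω => (x ω, y ω)) := fun i => by
    rw [(h.ident i).map_eq]
    refine Measure.map_congr ?_
    filter_upwards [hx, hy] with ω h1 h2
    rw [h1, h2]
  have : IsProbabilityMeasure (μ.map fun ω => (x ω, y ω)) :=
    Measure.isProbabilityMeasure_map (hxm.prodMk hym).aemeasurable
  rw [h1]
  simp_rw [h2]
  exact (Measure.pi_map_pi (μ := fun _ : Fin n => μ) (f := fun _ ω => (x ω, y ω))
    fun _ => (hxm.prodMk hym).aemeasurable).symm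

/-- The data sets on which least squares is well defined and `b`-close to `a` in the metric of
`S`. -/
def accurateData {n p : ℕ} (S : Matrix (Fin p) (Fin p) ℝ) (a : Fin p → ℝ) (b : ℝ) :
    Set (Fin n → (Fin p → ℝ) × ℝ) :=
  {D | ((of fun i => (D i).1)ᵀ * of fun i => (D i).1).det ≠ 0 ∧
    (((of fun i => (D i).1)ᵀ * of fun i => (D i).1)⁻¹ *ᵥ
      ((of fun i => (D i).1)ᵀ *ᵥ fun i => (D i).2) - a) ⬝ᵥ S *ᵥ
    (((of fun i => (D i).1)ᵀ * of fun i => (D i).1)⁻¹ *ᵥ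
      ((of fun i => (D i).1)ᵀ *ᵥ fun i => (D i).2) - a) ≤ b}

/-- Comparing laws requires a measurable set of data. The inverse is measurable as det⁻¹ times the
continuous adjugate. -/
theorem measurableSet_accurateData {n p : ℕ} (S : Matrix (Fin p) (Fin p) ℝ) (a : Fin p → ℝ)
    (b : ℝ) : MeasurableSet (accurateData (n := n) S a b) := by
  set X : (Fin n → (Fin p → ℝ) × ℝ) → Matrix (Fin n) (Fin p) ℝ := fun D => of fun i => (D i).1
  have hX : Continuous X := by
    refine continuous_matrix fun i j => ?_
    change Continuous fun D : Fin n → (Fin p → ℝ) × ℝ => (D i).1 j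
    fun_prop
  have hG : Continuous fun D => (X D)ᵀ * X D := hX.matrix_transpose.matrix_mul hX
  have hdet : Continuous fun D => ((X D)ᵀ * X D).det := hG.matrix_det
  have hy : Continuous fun D : Fin n → (Fin p → ℝ) × ℝ => fun i => (D i).2 := by fun_prop
  have hv : Continuous fun D => ((X D)ᵀ * X D).adjugate *ᵥ ((X D)ᵀ *ᵥ fun i => (D i).2) :=
    hG.matrix_adjugate.matrix_mulVec (hX.matrix_transpose.matrix_mulVec hy)
  have hinv : Measurable fun D => ((X D)ᵀ * X D)⁻¹ *ᵥ ((X D)ᵀ *ᵥ fun i => (D i).2) := by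
    have e : (fun D => ((X D)ᵀ * X D)⁻¹ *ᵥ ((X D)ᵀ *ᵥ fun i => (D i).2))
        = fun D => ((X D)ᵀ * X D).det⁻¹ •
          (((X D)ᵀ * X D).adjugate *ᵥ ((X D)ᵀ *ᵥ fun i => (D i).2)) := by
      funext D
      rw [Matrix.inv_def, Ring.inverse_eq_inv', Matrix.smul_mulVec]
    rw [e]
    exact hdet.measurable.inv.smul hv.measurable
  have hq : Measurable fun u : Fin p → ℝ => (u - a) ⬝ᵥ S *ᵥ (u - a) :=
    Continuous.measurable (by fun_prop)
  exact (hdet.measurable (measurableSet_singleton 0).compl).inter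
    (measurableSet_le (hq.comp hinv) measurable_const)

end FactorRegression

end

/-! ### The risk bound for least squares -/

open FactorRegression in
/-- For all sub-Gaussian constants there are `C₁`, `C₂`, depending on nothing else, such that for
all `c₀ ∈ (0, 1)`, `C > 0`, `c > 0`, all dimensions and all parameters `θ`, least squares
satisfies the excess risk bound with multiplicative constant `C₁` with probability at least
`1 - C₂ / n`. The new data point `(Xs, Ys)` lives on its own probability space `(Ω₀, μ)`, i.e. it
is independent of the sample. -/
theorem corollary5
    (γε γw γz : ℝ) (hγε : 0 < γε) (hγw : 0 < γw) (hγz : 0 < γz) :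
    ∃ C₁ C₂ : ℝ, 0 < C₁ ∧ 0 < C₂ ∧ ∀ c₀ C c : ℝ, 0 < c₀ → c₀ < 1 → 0 < C → 0 < c →
      ∀ (n p : ℕ) [NeZero n] [NeZero p] (θ : Param p),
        (p : ℝ) * Real.log n ≤ c₀ * n →
        (θ.K : ℝ) * Real.log n ≤ C * n →
        c < lambdaMin θ.SigmaW →
      ∀ (Ω₀ : Type*) [MeasurableSpace Ω₀] (μ : Measure Ω₀) [IsProbabilityMeasure μ]
        (Xs : Ω₀ → Fin p → ℝ) (Ys : Ω₀ → ℝ),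
        IsSubGaussianFRM γε γw γz μ θ Xs Ys →
      ∀ (Ω : Type*) [MeasurableSpace Ω] (P : Measure Ω) [IsProbabilityMeasure P]
        (X : Fin n → Ω → Fin p → ℝ) (Y : Fin n → Ω → ℝ),
        IsIIDSample P μ X Y Xs Ys →
        1 - C₂ / n ≤ P.real {ω |
          risk μ Xs Ys (Matrix.of fun i => X i ω) (fun i => Y i ω)
              (1 : Matrix (Fin p) (Fin p) ℝ) - θ.sigmaSq
            ≤ C₁ * (((p + Real.log n) / n * θ.sigmaSq
                + opNorm θ.SigmaW * (θ.β ⬝ᵥ ((θ.Aᵀ * θ.A)⁻¹ *ᵥ θ.β))) *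
              condNumber θ.SigmaW)} := by
  set Γ : ℝ := 1 + γε ^ 2 + γw ^ 2 + γz ^ 2 with hΓ
  have hΓ1 : 1 ≤ Γ := by nlinarith [sq_nonneg γε, sq_nonneg γw, sq_nonneg γz]
  set s : ℝ := 1 / (16 * Γ) with hs
  have hs0 : 0 < s := by positivity
  have hs1 : s ≤ 1 := by
    rw [hs, div_le_one (by positivity)]
    linarith
  have hsΓ : 16 * Γ * s ≤ 1 := by
    rw [hs, mul_one_div_cancel (by positivity)]
  set T : ℝ := √160 / s with hT
  have hT0 : 0 ≤ T := by positivity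
  have hTs : T ^ 2 * s ^ 2 = 160 := by
    rw [hT, div_pow, Real.sq_sqrt (by norm_num)]
    field_simp
  obtain ⟨N₀, hN⟩ := exists_forall_failure_le hs0 hTs
  -- The excess risk is at most 2b + 2r² with b = 64σ²t² + 8r² and t² = T²(p + log n)/n, which gives
  -- 128T² and 18. In the second constant, 3 is the failure bound for large n, and N₀ makes the
  -- claim trivial for n < N₀.
  refine ⟨128 * T ^ 2 + 18, N₀ + 3, by positivity, by positivity, ?_⟩
  intro c₀ C c _ hc₀ _ hc n p _ _ θ hpn _ hcW Ω₀ _ μ _ Xs Ys hmodel Ω _ P _ X Y hiid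
  have hn0 : 0 < n := Nat.pos_of_ne_zero (NeZero.ne n)
  have hn0' : (0 : ℝ) < n := by exact_mod_cast hn0
  rcases lt_or_ge n N₀ with hlt | hge
  · have h1 : (1 : ℝ) ≤ (N₀ + 3) / n := by
      rw [one_le_div hn0']
      have : (n : ℝ) ≤ N₀ := by exact_mod_cast hlt.le
      linarith
    linarith [measureReal_nonneg (μ := P) (s := {ω |
          risk μ Xs Ys (Matrix.of fun i => X i ω) (fun i => Y i ω)
              (1 : Matrix (Fin p) (Fin p) ℝ) - θ.sigmaSq
            ≤ (128 * T ^ 2 + 18) * (((p + Real.log n) / n * θ.sigmaSq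
                + opNorm θ.SigmaW * (θ.β ⬝ᵥ ((θ.Aᵀ * θ.A)⁻¹ *ᵥ θ.β))) *
              condNumber θ.SigmaW)})]
  have hp1 : 1 ≤ p := Nat.pos_of_ne_zero (NeZero.ne p)
  obtain ⟨ht8, hfail⟩ := hN n hge hn0 p hp1 (by nlinarith)
  set t := T * √((p + Real.log n) / n) with ht
  have ht0 : 0 ≤ t := by positivity
  have hlog : 0 ≤ Real.log n := Real.log_natCast_nonneg n
  have ht2 : t ^ 2 = T ^ 2 * ((p + Real.log n) / n) := by
    rw [ht, mul_pow, Real.sq_sqrt (by positivity)]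
  have hlam : 0 < lambdaMin θ.SigmaW := hc.trans hcW
  obtain ⟨hσ, S, a, x, e, w, r, hS, hdesign, hXae, hYae, hr, hrisk⟩ :=
    hmodel.exists_design (Γ := Γ) (posDef_of_lambdaMin_pos hlam)
      (by nlinarith [sq_nonneg γε, sq_nonneg γw, sq_nonneg γz])
      (by nlinarith [sq_nonneg γε, sq_nonneg γw, sq_nonneg γz])
      (by nlinarith [sq_nonneg γε, sq_nonneg γw, sq_nonneg γz])
  set σ := √θ.sigmaSq with hσdef
  have hσ2 : σ ^ 2 = θ.sigmaSq := Real.sq_sqrt hσ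
  set b := 64 * (σ ^ 2 * t ^ 2) + 8 * r ^ 2 with hb
  have hxm := hdesign.measurable_x
  set y : Ω₀ → ℝ := fun ω => x ω ⬝ᵥ a + σ * e ω - r * w ω with hy
  have hym : Measurable y := by
    have := hdesign.measurable_e
    have := hdesign.measurable_w
    simp only [hy, dotProduct]
    fun_prop
  set Q : Measure (Fin n → Ω₀) := Measure.pi fun _ : Fin n => μ with hQ
  set F : (Fin n → Ω₀) → Fin n → (Fin p → ℝ) × ℝ := fun ω i => (x (ω i), y (ω i)) with hF
  set D : Ω → Fin n → (Fin p → ℝ) × ℝ := fun ω i => (X i ω, Y i ω) with hD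
  have hFm : Measurable F := by fun_prop
  have hDm : AEMeasurable D P := aemeasurable_pi_lambda _ fun i => (hiid.ident i).aemeasurable_fst
  have hbad := hdesign.measure_not_isGoodSample_le hS (by linarith) hs0 hs1 hsΓ ht0 ht8 n
  have hgood : {ω | IsGoodSample S t (fun i => x (ω i)) (fun i => e (ω i)) (fun i => w (ω i))}
      ⊆ F ⁻¹' accurateData S a b := by
    intro ω hω
    have hω' : IsGoodSample S t (of fun i => x (ω i)) (fun i => e (ω i)) (fun i => w (ω i)) := hω
    exact ⟨hω'.det_ne_zero hn0 hS, hω'.estimation_error_le hn0 hS (Real.sqrt_nonneg _)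
      (fun i => rfl) rfl⟩
  -- Only an inclusion is needed, so measurability of the risk event itself plays no role.
  have hsub : D ⁻¹' accurateData S a b ⊆ {ω |
      risk μ Xs Ys (Matrix.of fun i => X i ω) (fun i => Y i ω)
          (1 : Matrix (Fin p) (Fin p) ℝ) - θ.sigmaSq
        ≤ (128 * T ^ 2 + 18) * (((p + Real.log n) / n * θ.sigmaSq
            + opNorm θ.SigmaW * (θ.β ⬝ᵥ ((θ.Aᵀ * θ.A)⁻¹ *ᵥ θ.β))) *
          condNumber θ.SigmaW)} := by
    rintro ω ⟨hdet, hacc⟩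
    change risk _ _ _ _ _ _ - _ ≤ _
    rw [risk, coef_one hdet]
    have h1 := hrisk (((of fun i => X i ω)ᵀ * of fun i => X i ω)⁻¹ *ᵥ
      ((of fun i => X i ω)ᵀ *ᵥ fun i => Y i ω))
    set m := opNorm θ.SigmaW * (θ.β ⬝ᵥ ((θ.Aᵀ * θ.A)⁻¹ *ᵥ θ.β))
    set l := (p + Real.log n) / n with hl
    have hl0 : 0 ≤ l := by positivity
    have hm0 : 0 ≤ m := (sq_nonneg r).trans hr
    have h2 : b = 64 * (θ.sigmaSq * (T ^ 2 * l)) + 8 * r ^ 2 := by rw [hb, hσ2, ht2]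
    have h3 : (128 * T ^ 2 + 18) * (l * θ.sigmaSq + m)
        ≤ (128 * T ^ 2 + 18) * ((l * θ.sigmaSq + m) * condNumber θ.SigmaW) :=
      mul_le_mul_of_nonneg_left
        (le_mul_of_one_le_right (by positivity) (one_le_condNumber hlam)) (by positivity)
    have h4 : 0 ≤ l * θ.sigmaSq := by positivity
    have h5 : 0 ≤ T ^ 2 * m := by positivity
    refine le_trans ?_ h3
    linarith
  have hprob : 1 ≤ Q.real (F ⁻¹' accurateData S a b) + 3 / n := by
    have h1 : (Set.univ : Set (Fin n → Ω₀))
        ⊆ F ⁻¹' accurateData S a b ∪ {ω | ¬ IsGoodSample S t (fun i => x (ω i))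
            (fun i => e (ω i)) (fun i => w (ω i))} := by
      intro ω _
      by_cases hω : IsGoodSample S t (fun i => x (ω i)) (fun i => e (ω i)) (fun i => w (ω i))
      · exact Or.inl (hgood hω)
      · exact Or.inr hω
    have h2 := (measureReal_mono (μ := Q) h1).trans (measureReal_union_le _ _)
    rw [probReal_univ] at h2
    linarith
  -- The noise and the remainder exist only on the model space, so good samples live on its n-fold
  -- product. Accuracy depends on the data alone and passes to `P` by equality of laws.
  have hmap : P.real (D ⁻¹' accurateData S a b) = Q.real (F ⁻¹' accurateData S a b) := by
    have hG := measurableSet_accurateData (n := n) S a b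
    rw [← map_measureReal_apply_of_aemeasurable hDm hG, ← map_measureReal_apply hFm hG, hD,
      hiid.map_eq hXae hYae hxm hym]
  have hmono : P.real (D ⁻¹' accurateData S a b) ≤ _ := measureReal_mono hsub
  have h3 : (3 : ℝ) / n ≤ (N₀ + 3) / n := by
    gcongr
    linarith [(Nat.cast_nonneg N₀ : (0 : ℝ) ≤ N₀)]
  linarith
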